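/- For $\nu\ge 0$, $z>0$ let $I_\nu(z)=\sum_{k\ge 0}\frac{(z/2)^{2k+\nu}}{k!\,\Gamma(k+\nu+1)}$ be the modified Bessel function of the first kind. Let $l\ge 1$ be an integer, $\alpha\ge 0$ real, and $$\tau_{l,\alpha}(x)=\det\big[I_{j+k+\alpha}(2\sqrt x)\big]_{j,k=0}^{l-1}\qquad(x>0).$$ Put $A=l^2+l(\alpha-1)$. For a smooth function $f$ on $(0,\infty)$ define functions $\tau_{m,j}[f]$, $1\le j\le m$ (indexed by the hook diagrams $Y_{m,j}=(m-j+1,1,\dots,1)$ of weight $m$), by the initial expressions $$\tau_{1,1}[f]=\sqrt x\,f'-\frac{A}{2\sqrt x}f,$$ $$\tau_{2,1}[f]=\frac x2 f''-\frac{l(l+\alpha+1)+\alpha-1}{2}f'+\frac{A\,(l^2+l(\alpha+3)+2\alpha)+4lx}{8x}f,$$ $$\tau_{2,2}[f]=\frac x2 f''-\frac{l(l+\alpha-3)-(\alpha-1)}{2}f'+\frac{A\,(l^2+l(\alpha-5)+4-2\alpha)-4lx}{8x}f,$$ and, for $m\ge 3$ and $1\le j\le m$, by the recursion $$\tau_{m,j}[f]=\sum_{k=1}^{m-1}\Big(-\sqrt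 x\,B^{(m)}_{jk}\frac{d}{dx}\tau_{m-1,k}[f]+\frac{A+m-1}{2\sqrt x}B^{(m)}_{jk}\tau_{m-1,k}[f]-\frac1{\sqrt x}C^{(m)}_{1,jk}\tau_{m-1,k}[f]\Big)+\sum_{k=1}^{m-2}C^{(m)}_{2,jk}\tau_{m-2,k}[f],$$ where $B^{(m)}_{jk}=\frac{(-1)^{j+k-1}}{k(k+1)}$ for $j\le k\le m-1$, $-\frac1j$ for $k=j-1$, and $0$ for $k<j-1$; $C^{(m)}_{1,jk}=(-1)^{j+k}\big(\frac{m-1-k}{k+1}+\frac{2l-k+\alpha}{k(k+1)}\big)$ for $j\le k\le m-1$, $-\frac{1}{k+1}\big(k(2l-k+\alpha)+m-1-k\big)$ for $k=j-1$, and $0$ for $k<j-1$; $C^{(m)}_{2,jk}=(-1)^{j+k}\frac{l+2}{(k+1)(k+2)}$ for $j-1\le k\le m-2$, $\frac{j-l-2}{j}$ for $k=j-2$, and $0$ for $k<j-2$. Write $\tau_{l,Y_{l+1,l+1},\alpha}:=\tau_{l+1,l+1}[\tau_{l,\alpha}]$. Let the real numbers $b^{(m,j)}_{i,n}$ (depending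 only on $l,\alpha,m,j,i,n$) be the coefficients obtained by writing each $\tau_{m,j}[f]$ as $x^{-m/2}\sum_{n,i\ge0}b^{(m,j)}_{i,n}x^{n+i}f^{(n)}$; that is, those for $m=1,2$ are read off from the initial expressions, and, for $m\ge3$, $$b^{(m,j)}_{i,n}=\sum_{k=1}^{m-1}\Big[-B^{(m)}_{jk}\Big(\big(n+i-\tfrac{m-1}2\big)b^{(m-1,k)}_{i,n}+b^{(m-1,k)}_{i,n-1}\Big)+\frac{A+m-1}{2}B^{(m)}_{jk}b^{(m-1,k)}_{i,n}-C^{(m)}_{1,jk}b^{(m-1,k)}_{i,n}\Big]+\sum_{k=1}^{m-2}C^{(m)}_{2,jk}b^{(m-2,k)}_{i-1,n},$$ with the convention that coefficients with a negative index are $0$. Put $b_{j,n}^{(l+1)}(\alpha):=b^{(l+1,l+1)}_{j,n}$. Theorem. The function $\tau_{l,\alpha}$ is smooth on $(0,\infty)$. For every smooth $f$ on $(0,\infty)$, in particular for $f=\tau_{l,\alpha}$, and all $x>0$, $$\tau_{l+1,l+1}[f](x)=x^{-\frac{l+1}2}\sum_{n=0}^{l+1}x^n\Big(\sum_{j=0}^{\lfloor\frac{l+1-n}2\rfloor}b_{j,n}^{(l+1)}(\alpha)\,x^j\Big)\frac{d^nf(x)}{dx^n}.$$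 Moreover $\tau_{l,Y_{l+1,l+1},\alpha}(x)=0$ for all $x>0$, so that for all $x>0$ $$\sum_{n=0}^{l+1}x^n\Big(\sum_{j=0}^{\lfloor\frac{l+1-n}2\rfloor}b_{j,n}^{(l+1)}(\alpha)\,x^j\Big)\frac{d^n\tau_{l,\alpha}(x)}{dx^n}=0,$$ a linear differential equation of order exactly $l+1$, that is, $b_{0,l+1}^{(l+1)}(\alpha)\ne0$. In particular, taking $\alpha=1$, the Hankel determinant $\tau_l(x)=\det[I_{j+k+1}(2\sqrt x)]_{j,k=0}^{l-1}$ satisfies $$\sum_{n=0}^{l+1}x^n\Big(\sum_{j=0}^{\lfloor\frac{l+1-n}2\rfloor}b_{j,n}^{(l+1)}(1)\,x^j\Big)\frac{d^n\tau_l(x)}{dx^n}=0\qquad(x>0).$$ -/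

import Mathlib

open scoped Nat ContDiff

noncomputable section

namespace HankelODE

/-- The modified Bessel function of the first kind
`I_ν(z) = ∑_{k ≥ 0} (z/2)^(2k+ν) / (k! Γ(k+ν+1))`, for real order `ν` and argument `z`
(used only for `ν ≥ 0` and `z > 0`). -/
def besselI (ν z : ℝ) : ℝ :=
  ∑' k : ℕ, (z / 2) ^ (2 * (k : ℝ) + ν) / ((k ! : ℝ) * Real.Gamma ((k : ℝ) + ν + 1))

/-- The Hankel determinant `τ_{l,α}(x) = det [I_{j+k+α}(2√x)]_{j,k=0}^{l-1}`. -/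
def tau (l : ℕ) (α x : ℝ) : ℝ :=
  (Matrix.of fun j k : Fin l => besselI ((j : ℝ) + (k : ℝ) + α) (2 * √x)).det

/-- Entries of the `m × m` matrix `B^(m)`, indices `1 ≤ j, k ≤ m`. -/
def matB (m j k : ℕ) : ℝ :=
  if k = m then (-1) ^ (j - 1) / (m : ℝ)
  else if j ≤ k then (-1) ^ (j + k - 1) / ((k : ℝ) * ((k : ℝ) + 1))
  else if k + 1 = j then -1 / (j : ℝ)
  else 0

/-- Entries of the `m × (m-1)` matrix `C₁^(m)`, indices `1 ≤ j ≤ m`, `1 ≤ k ≤ m - 1`. -/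
def matC₁ (l : ℕ) (α : ℝ) (m j k : ℕ) : ℝ :=
  if j ≤ k then
    (-1) ^ (j + k) * (((m : ℝ) - 1 - k) / ((k : ℝ) + 1)
      + (2 * (l : ℝ) - k + α) / ((k : ℝ) * ((k : ℝ) + 1)))
  else if k + 1 = j then
    -(1 / ((k : ℝ) + 1)) * ((k : ℝ) * (2 * (l : ℝ) - k + α) + (m : ℝ) - 1 - k)
  else 0

/-- Entries of the `m × (m-2)` matrix `C₂^(m)`, indices `1 ≤ j ≤ m`, `1 ≤ k ≤ m - 2`. -/
def matC₂ (l j k : ℕ) : ℝ :=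
  if j ≤ k + 1 then (-1) ^ (j + k) * (((l : ℝ) + 2) / (((k : ℝ) + 1) * ((k : ℝ) + 2)))
  else if k + 2 = j then ((j : ℝ) - l - 2) / (j : ℝ)
  else 0

/-- The functions attached to the hook diagrams `Y_{m,j} = (m-j+1, 1, …, 1)`, `1 ≤ j ≤ m`,
produced from a function `f` by the initial expressions (`m = 1, 2`) and the recursive formula
(`m ≥ 3`); for `f = τ_{l,α}` these are the functions `τ_{l,Y_{m,j},α}`.
The vectors multiplied by `B^(m)` have last entry `0`, so the index `k = m` does not occur.
The value at `m = 0` (the empty diagram) is `f`; indices `j` outside `1, …, m` are never used. -/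
def hookTau (l : ℕ) (α : ℝ) (f : ℝ → ℝ) : ℕ → ℕ → ℝ → ℝ
  | 0, _, x => f x
  | 1, _, x => √x * deriv f x - ((l : ℝ) ^ 2 + l * (α - 1)) / (2 * √x) * f x
  | 2, j, x =>
    if j = 1 then
      x / 2 * iteratedDeriv 2 f x - (l * (l + α + 1) + α - 1) / 2 * deriv f x
        + (((l : ℝ) ^ 2 + l * (α - 1)) * ((l : ℝ) ^ 2 + l * (α + 3) + 2 * α) + 4 * l * x)
          / (8 * x) * f x
    else
      x / 2 * iteratedDeriv 2 f x - (l * (l + α - 3) - (α - 1)) / 2 * deriv f x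
        + (((l : ℝ) ^ 2 + l * (α - 1)) * ((l : ℝ) ^ 2 + l * (α - 5) + 4 - 2 * α) - 4 * l * x)
          / (8 * x) * f x
  | m + 3, j, x =>
    -√x * ∑ k ∈ Finset.Icc 1 (m + 2), matB (m + 3) j k * deriv (hookTau l α f (m + 2) k) x
      + ((l : ℝ) ^ 2 + l * (α - 1) + ((m + 3 : ℕ) : ℝ) - 1) / (2 * √x)
        * ∑ k ∈ Finset.Icc 1 (m + 2), matB (m + 3) j k * hookTau l α f (m + 2) k x
      - 1 / √x * ∑ k ∈ Finset.Icc 1 (m + 2), matC₁ l α (m + 3) j k * hookTau l α f (m + 2) k x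
      + ∑ k ∈ Finset.Icc 1 (m + 1), matC₂ l j k * hookTau l α f (m + 1) k x

/-- The recursively given coefficients. `hookCoeff l α m j i n` is the coefficient of
`x^(-m/2) x^n x^i (d/dx)^n` in the differential operator attached to `Y_{m,j}`;
the coefficient `b_{i,n}^{(m)}(α)` is the one with `j = m`. -/
def hookCoeff (l : ℕ) (α : ℝ) : ℕ → ℕ → ℕ → ℕ → ℝ
  | 0, _, i, n => if i = 0 ∧ n = 0 then 1 else 0
  | 1, _, i, n =>
    if i = 0 ∧ n = 1 then 1
    else if i = 0 ∧ n = 0 then -((l : ℝ) ^ 2 + l * (α - 1)) / 2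
    else 0
  | 2, j, i, n =>
    if i = 0 ∧ n = 2 then 1 / 2
    else if i = 0 ∧ n = 1 then
      if j = 1 then -(l * (l + α + 1) + α - 1) / 2 else -(l * (l + α - 3) - (α - 1)) / 2
    else if i = 0 ∧ n = 0 then
      if j = 1 then ((l : ℝ) ^ 2 + l * (α - 1)) * ((l : ℝ) ^ 2 + l * (α + 3) + 2 * α) / 8
      else ((l : ℝ) ^ 2 + l * (α - 1)) * ((l : ℝ) ^ 2 + l * (α - 5) + 4 - 2 * α) / 8
    else if i = 1 ∧ n = 0 then
      if j = 1 then (l : ℝ) / 2 else -(l : ℝ) / 2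
    else 0
  | m + 3, j, i, n =>
    -∑ k ∈ Finset.Icc 1 (m + 2), matB (m + 3) j k *
        (((n : ℝ) + i - ((m + 2 : ℕ) : ℝ) / 2) * hookCoeff l α (m + 2) k i n
          + if n = 0 then 0 else hookCoeff l α (m + 2) k i (n - 1))
      + ((l : ℝ) ^ 2 + l * (α - 1) + ((m + 3 : ℕ) : ℝ) - 1) / 2
        * ∑ k ∈ Finset.Icc 1 (m + 2), matB (m + 3) j k * hookCoeff l α (m + 2) k i n
      - ∑ k ∈ Finset.Icc 1 (m + 2), matC₁ l α (m + 3) j k * hookCoeff l α (m + 2) k i n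
      + ∑ k ∈ Finset.Icc 1 (m + 1), matC₂ l j k *
          (if i = 0 then 0 else hookCoeff l α (m + 1) k (i - 1) n)

/-- The coefficient `b_{j,n}^{(m)}(α)`. -/
def bCoeff (l : ℕ) (α : ℝ) (m j n : ℕ) : ℝ := hookCoeff l α m m j n

/-- The differential expression
`∑_{n=0}^{l+1} x^n (∑_{j=0}^{⌊(l+1-n)/2⌋} b_{j,n}^{(l+1)}(α) x^j) f^{(n)}(x)`. -/
def odeExpr (l : ℕ) (α : ℝ) (f : ℝ → ℝ) (x : ℝ) : ℝ :=
  ∑ n ∈ Finset.range (l + 2),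
    x ^ n * (∑ j ∈ Finset.range ((l + 1 - n) / 2 + 1), bCoeff l α (l + 1) j n * x ^ j)
      * iteratedDeriv n f x

end HankelODE

end

/-! Treat the numbers `I_{n+α}(2√x)` as the moments of a measure in one variable and apply the
corresponding linear functional in each of `l` variables (`momentFunctional`). By Heine's identity
(`momentFunctional_vand_sq`) `tau l α` is the average of `1` against the squared Vandermonde
determinant, divided by `l!`. No measure is needed: two Bessel identities suffice. The derivative
formula turns multiplication by the sum of the variables into a first-order operator in `x`
(`average_sum_X_mul`), and the three-term recurrence acts as integration by parts.

Integrating by parts with the test polynomials `Δ² · ∂ᵢe_{b+1} · h_k` and summing over `i` gives a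
loop equation (`average_loop_equation`), which is a relation between averages of adjacent hook Schur
polynomials. The matrices `B`, `C₁`, `C₂` are the solution of these relations: sums of adjacent rows
have at most two nonzero entries. So `hookTau l α (tau l α) m j` is the average of the hook Schur
polynomial of `m`, `j` (`hookTau_tau`). For `m = j = l + 1` this polynomial is `e_{l+1}`, which is
zero in `l` variables.

Independently, for every smooth `f`, the recursion of the functions translates into that of the
coefficients (`hookTau_eq_diffExpr`). A weight count bounds their support (`hookCoeff_eq_zero`), and
the leading coefficient is `1/m!` (`hookCoeff_top`). -/

noncomputable section

namespace HankelODE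

/-! ### Bessel functions: derivative and three-term recurrence. -/

/-- The entire part of the Bessel function: `I_ν(2√x) = √x ^ ν * besselSeries ν x`. -/
def besselSeries (ν x : ℝ) : ℝ :=
  ∑' k : ℕ, x ^ k / ((k ! : ℝ) * Real.Gamma ((k : ℝ) + ν + 1))

/-- `Γ` is not monotone on `[1, 2]`, but each unit step multiplies by `k + ν + 1 ≥ 1`. This lets the
exponential series dominate the Bessel series. -/
lemma Gamma_le_Gamma_nat_add {ν : ℝ} (hν : 0 ≤ ν) (k : ℕ) :
    Real.Gamma (ν + 1) ≤ Real.Gamma ((k : ℝ) + ν + 1) := by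
  induction k with
  | zero => simp
  | succ k ih =>
    have hpos : 0 < (k : ℝ) + ν + 1 := by positivity
    have h := Real.Gamma_add_one hpos.ne'
    have hG := Real.Gamma_pos_of_pos hpos
    have hrw : ((k + 1 : ℕ) : ℝ) + ν + 1 = (k : ℝ) + ν + 1 + 1 := by push_cast; ring
    rw [hrw, h]
    have hk : (0 : ℝ) ≤ k := Nat.cast_nonneg k
    nlinarith [mul_nonneg (add_nonneg hk hν) hG.le]

lemma abs_besselSeries_term_le {ν : ℝ} (hν : 0 ≤ ν) (y : ℝ) (k : ℕ) :
    |y / ((k ! : ℝ) * Real.Gamma ((k : ℝ) + ν + 1))| ≤ |y| / k ! / Real.Gamma (ν + 1) := by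
  have h0 : 0 < Real.Gamma (ν + 1) := Real.Gamma_pos_of_pos (by positivity)
  have h1 := Gamma_le_Gamma_nat_add hν k
  have hk : (0 : ℝ) < k ! := by exact_mod_cast Nat.factorial_pos k
  rw [abs_div, abs_of_pos (mul_pos hk (h0.trans_le h1)), div_div]
  gcongr

lemma summable_besselSeries {ν : ℝ} (hν : 0 ≤ ν) (x : ℝ) :
    Summable fun k : ℕ => x ^ k / ((k ! : ℝ) * Real.Gamma ((k : ℝ) + ν + 1)) := by
  refine Summable.of_norm_bounded ((Real.summable_pow_div_factorial |x|).div_const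
    (Real.Gamma (ν + 1))) fun k => ?_
  rw [Real.norm_eq_abs, ← abs_pow]
  exact abs_besselSeries_term_le hν _ k

lemma succ_mul_div_factorial (y : ℝ) (k : ℕ) (g : ℝ) :
    (((k + 1 : ℕ) : ℝ) * y) / (((k + 1)! : ℝ) * g) = y / ((k ! : ℝ) * g) := by
  have hk : (k ! : ℝ) ≠ 0 := by exact_mod_cast Nat.factorial_ne_zero k
  have hk1 : ((k : ℝ) + 1) ≠ 0 := by positivity
  rw [Nat.factorial_succ]
  push_cast
  rw [mul_assoc, mul_div_mul_left _ _ hk1]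

lemma hasDerivAt_besselSeries {ν : ℝ} (hν : 0 ≤ ν) (x : ℝ) :
    HasDerivAt (besselSeries ν) (besselSeries (ν + 1) x) x := by
  set r : ℝ := |x| + 1 with hr
  have hr0 : 0 ≤ r := by positivity
  have hbound : Summable fun k : ℕ => ((k : ℝ) * r ^ (k - 1)) / k ! / Real.Gamma (ν + 1) := by
    refine Summable.div_const ?_ _
    -- The term `k = 0` vanishes, so the truncated exponent `k - 1` is harmless; after the shift
    -- this is the exponential series at `r`.
    rw [← summable_nat_add_iff 1]
    refine (Real.summable_pow_div_factorial r).congr fun k => ?_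
    have := succ_mul_div_factorial (r ^ k) k 1
    simp only [mul_one] at this
    rw [Nat.add_sub_cancel, this]
  have hmain := hasDerivAt_tsum_of_isPreconnected hbound (t := Metric.ball (0 : ℝ) r)
    (g := fun k y => y ^ k / ((k ! : ℝ) * Real.Gamma ((k : ℝ) + ν + 1)))
    (g' := fun k y => ((k : ℝ) * y ^ (k - 1)) / ((k ! : ℝ) * Real.Gamma ((k : ℝ) + ν + 1)))
    (y₀ := 0) (y := x) Metric.isOpen_ball (convex_ball _ _).isPreconnected
    (fun k y _ => (hasDerivAt_pow k y).div_const _)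
    (fun k y hy => by
      rw [Real.norm_eq_abs]
      refine (abs_besselSeries_term_le hν _ k).trans ?_
      have h0 : 0 < Real.Gamma (ν + 1) := Real.Gamma_pos_of_pos (by positivity)
      have hy' : |y| ≤ r := by
        have := Metric.mem_ball.1 hy
        rw [Real.dist_eq, sub_zero] at this
        exact this.le
      rw [abs_mul, abs_pow, Nat.abs_cast]
      gcongr)
    (by simp [hr]; positivity) (summable_besselSeries hν 0)
    (by simp [hr])
  refine HasDerivAt.congr_deriv (f := besselSeries ν) hmain ?_
  have hs : Summable fun k : ℕ =>
      ((k : ℝ) * x ^ (k - 1)) / ((k ! : ℝ) * Real.Gamma ((k : ℝ) + ν + 1)) := by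
    rw [← summable_nat_add_iff 1]
    refine (summable_besselSeries (ν := ν + 1) (by positivity) x).congr fun k => ?_
    rw [succ_mul_div_factorial, Nat.add_sub_cancel]
    push_cast
    ring_nf
  rw [hs.tsum_eq_zero_add]
  simp only [Nat.cast_zero, zero_mul, zero_div, zero_add, besselSeries]
  refine tsum_congr fun k => ?_
  rw [succ_mul_div_factorial, Nat.add_sub_cancel]
  push_cast
  ring_nf

/-- Write `1/Γ(k+ν+1) = (k+ν+1)/Γ(k+ν+2)` and split the numerator into `ν + 1` and `k`; the factor
`k` cancels against `k!` and shifts the index. -/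
lemma besselSeries_three_term {ν : ℝ} (hν : 0 ≤ ν) (x : ℝ) :
    besselSeries ν x = (ν + 1) * besselSeries (ν + 1) x + x * besselSeries (ν + 2) x := by
  have h1 := summable_besselSeries (ν := ν + 1) (by positivity) x
  have h2 := summable_besselSeries (ν := ν + 2) (by positivity) x
  have h0 := summable_besselSeries hν x
  have hs : Summable fun k : ℕ =>
      ((k : ℝ) * x ^ k) / ((k ! : ℝ) * Real.Gamma ((k : ℝ) + ν + 2)) := by
    rw [← summable_nat_add_iff 1]
    refine (h2.mul_left x).congr fun k => ?_
    rw [succ_mul_div_factorial]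
    push_cast
    rw [show (k : ℝ) + 1 + ν + 2 = k + (ν + 2) + 1 by ring]
    ring
  have e2 : x * besselSeries (ν + 2) x =
      ∑' k : ℕ, ((k : ℝ) * x ^ k) / ((k ! : ℝ) * Real.Gamma ((k : ℝ) + ν + 2)) := by
    rw [hs.tsum_eq_zero_add, besselSeries, ← tsum_mul_left]
    simp only [Nat.cast_zero, zero_mul, zero_div, zero_add]
    refine tsum_congr fun k => ?_
    rw [succ_mul_div_factorial]
    push_cast
    rw [show (k : ℝ) + 1 + ν + 2 = k + (ν + 2) + 1 by ring]
    ring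
  rw [e2, besselSeries, besselSeries, ← tsum_mul_left, ← (h1.mul_left (ν + 1)).tsum_add hs]
  refine tsum_congr fun k => ?_
  have hpos : 0 < (k : ℝ) + ν + 1 := by positivity
  have hG := Real.Gamma_add_one hpos.ne'
  have hGp := Real.Gamma_pos_of_pos hpos
  have hk : (k ! : ℝ) ≠ 0 := by exact_mod_cast Nat.factorial_ne_zero k
  rw [show (k : ℝ) + (ν + 1) + 1 = k + ν + 1 + 1 by ring,
    show (k : ℝ) + ν + 2 = k + ν + 1 + 1 by ring, hG]
  field_simp
  ring

lemma besselI_two_mul_sqrt (ν : ℝ) {x : ℝ} (hx : 0 < x) :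
    besselI ν (2 * √x) = x ^ (ν / 2) * besselSeries ν x := by
  rw [besselI, besselSeries, ← tsum_mul_left]
  refine tsum_congr fun k => ?_
  have h : (2 * √x / 2) ^ (2 * (k : ℝ) + ν) = x ^ (ν / 2) * x ^ k := by
    rw [mul_div_cancel_left₀ _ (two_ne_zero' ℝ), Real.sqrt_eq_rpow, ← Real.rpow_mul hx.le,
      ← Real.rpow_natCast, ← Real.rpow_add hx]
    congr 1
    ring
  rw [h, mul_div_assoc]

lemma hasDerivAt_besselI_two_mul_sqrt {ν : ℝ} (hν : 0 ≤ ν) {x : ℝ} (hx : 0 < x) :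
    HasDerivAt (fun y => besselI ν (2 * √y))
      (besselI (ν + 1) (2 * √x) / √x + ν / (2 * x) * besselI ν (2 * √x)) x := by
  have h := ((Real.hasDerivAt_rpow_const (p := ν / 2) (Or.inl hx.ne')).mul
    (hasDerivAt_besselSeries hν x))
  have hev : (fun y => besselI ν (2 * √y)) =ᶠ[nhds x]
      (fun y => y ^ (ν / 2)) * besselSeries ν := by
    filter_upwards [lt_mem_nhds hx] with y hy
    exact besselI_two_mul_sqrt ν hy
  refine (h.congr_of_eventuallyEq hev).congr_deriv ?_
  rw [besselI_two_mul_sqrt _ hx, besselI_two_mul_sqrt _ hx, Real.rpow_sub hx, Real.rpow_one,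
    add_div ν 1 2, Real.rpow_add hx, ← Real.sqrt_eq_rpow]
  have hs : √x ≠ 0 := (Real.sqrt_pos.2 hx).ne'
  field_simp
  ring

lemma besselI_three_term {ν : ℝ} (hν : 0 ≤ ν) {x : ℝ} (hx : 0 < x) :
    (ν + 1) * besselI (ν + 1) (2 * √x)
      + √x * (besselI (ν + 2) (2 * √x) - besselI ν (2 * √x)) = 0 := by
  rw [besselI_two_mul_sqrt _ hx, besselI_two_mul_sqrt _ hx, besselI_two_mul_sqrt _ hx,
    besselSeries_three_term hν, add_div ν 1 2, add_div ν 2 2, div_self (two_ne_zero' ℝ),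
    Real.rpow_add hx, Real.rpow_add hx, ← Real.sqrt_eq_rpow, Real.rpow_one]
  ring

section

open MvPolynomial Finset

variable {l : ℕ}

/-! ### Elementary and complete symmetric polynomials -/

/-- The elementary symmetric polynomials in `l` variables. -/
abbrev elemSymm (l k : ℕ) : MvPolynomial (Fin l) ℝ := esymm (Fin l) ℝ k

lemma elemSymm_zero : elemSymm l 0 = 1 := esymm_zero _ _

lemma elemSymm_isHomogeneous (k : ℕ) : (elemSymm l k).IsHomogeneous k := by
  refine IsHomogeneous.sum _ _ _ fun t ht => ?_
  have h := IsHomogeneous.prod t (fun i : Fin l => (X i : MvPolynomial (Fin l) ℝ)) (fun _ => 1)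
    fun i _ => isHomogeneous_X _ _
  rwa [sum_const, smul_eq_mul, mul_one, (mem_powersetCard.1 ht).2] at h

lemma elemSymm_eq_zero {k : ℕ} (hk : l < k) : elemSymm l k = 0 := by
  rw [elemSymm, esymm, powersetCard_eq_empty.2 (by simpa using hk), sum_empty]

lemma pderiv_prod_X_eq_zero {i : Fin l} {t : Finset (Fin l)} (hi : i ∉ t) :
    pderiv i (∏ j ∈ t, (X j : MvPolynomial (Fin l) ℝ)) = 0 := by
  induction t using Finset.induction_on with
  | empty => simp
  | insert a s ha ih =>
    rw [mem_insert, not_or] at hi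
    rw [prod_insert ha, Derivation.leibniz, ih hi.2, pderiv_X_of_ne (Ne.symm hi.1)]
    simp

/-- With `r n` the elementary polynomials in the other variables, `e_{n+1} = r_{n+1} + Xᵢ rₙ`, so
`rₙ = ∂ᵢe_{n+1}`; substituting back gives the identity. -/
lemma pderiv_elemSymm_succ_add (i : Fin l) (k : ℕ) :
    pderiv i (elemSymm l (k + 1)) + X i * pderiv i (elemSymm l k) = elemSymm l k := by
  set r : ℕ → MvPolynomial (Fin l) ℝ := fun n =>
    ∑ t ∈ powersetCard n (univ.erase i), ∏ j ∈ t, X j with hr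
  have hr0 : ∀ n, pderiv i (r n) = 0 := fun n => by
    rw [hr, map_sum]
    refine sum_eq_zero fun t ht => pderiv_prod_X_eq_zero fun hi => ?_
    exact notMem_erase i _ ((mem_powersetCard.1 ht).1 hi)
  have hsucc : ∀ n, elemSymm l (n + 1) = r (n + 1) + X i * r n := fun n => by
    have h : (univ : Finset (Fin l)) = insert i (univ.erase i) := by simp
    rw [elemSymm, esymm, h, powersetCard_succ_insert (notMem_erase i _), sum_union, hr]
    · congr 1
      rw [sum_image, mul_sum]
      · refine sum_congr rfl fun t ht => prod_insert fun hi => ?_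
        exact notMem_erase i _ ((mem_powersetCard.1 ht).1 hi)
      · intro s hs t ht hst
        have hs' : i ∉ s := fun hi => notMem_erase i _ ((mem_powersetCard.1 hs).1 hi)
        have ht' : i ∉ t := fun hi => notMem_erase i _ ((mem_powersetCard.1 ht).1 hi)
        rw [← erase_insert hs', ← erase_insert ht']
        exact congrArg (fun u => u.erase i) hst
    · rw [disjoint_left]
      intro s hs hs'
      obtain ⟨t, -, rfl⟩ := mem_image.1 hs'
      exact notMem_erase i _ ((mem_powersetCard.1 hs).1 (mem_insert_self i t))
  have hd : ∀ n, pderiv i (elemSymm l (n + 1)) = r n := fun n => by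
    rw [hsucc, map_add, Derivation.leibniz, hr0, hr0, pderiv_X_self]
    simp
  cases k with
  | zero => rw [hd, elemSymm_zero]; simp [hr]
  | succ k => rw [hd, hd, hsucc]

lemma pderiv_pderiv_elemSymm (i : Fin l) (k : ℕ) : pderiv i (pderiv i (elemSymm l k)) = 0 := by
  induction k with
  | zero => rw [elemSymm_zero]; simp
  | succ k ih =>
    have h := congrArg (pderiv i) (pderiv_elemSymm_succ_add i k)
    rw [map_add, Derivation.leibniz, ih, pderiv_X_self] at h
    simpa using h

lemma sum_X_mul_pderiv_elemSymm (k : ℕ) :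
    ∑ i, X i * pderiv i (elemSymm l k) = (k : MvPolynomial (Fin l) ℝ) * elemSymm l k := by
  rw [(elemSymm_isHomogeneous k).sum_X_mul_pderiv, nsmul_eq_mul]

lemma sum_pderiv_elemSymm (k : ℕ) :
    ∑ i, pderiv i (elemSymm l (k + 1)) = ((l : MvPolynomial (Fin l) ℝ) - k) * elemSymm l k := by
  have h : ∑ i, (pderiv i (elemSymm l (k + 1)) + X i * pderiv i (elemSymm l k))
      = ∑ _i : Fin l, elemSymm l k := sum_congr rfl fun i _ => pderiv_elemSymm_succ_add i k
  rw [sum_add_distrib, sum_X_mul_pderiv_elemSymm, sum_const, card_univ, Fintype.card_fin,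
    nsmul_eq_mul] at h
  linear_combination h

/-- The generating series `∑ (-1)^k e_k t^k`. -/
def elemSeries (l : ℕ) : PowerSeries (MvPolynomial (Fin l) ℝ) :=
  PowerSeries.mk fun k => (-1) ^ k * elemSymm l k

/-- The complete symmetric polynomials in `l` variables, by their generating series. -/
def compSymm (l n : ℕ) : MvPolynomial (Fin l) ℝ :=
  PowerSeries.coeff n (PowerSeries.invOfUnit (elemSeries l) 1)

lemma elemSeries_mul_mk_compSymm : elemSeries l * PowerSeries.mk (compSymm l) = 1 := by
  have h : PowerSeries.mk (compSymm l) = PowerSeries.invOfUnit (elemSeries l) 1 := by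
    ext1 n
    rw [PowerSeries.coeff_mk, compSymm]
  rw [h]
  refine PowerSeries.mul_invOfUnit _ _ ?_
  rw [← PowerSeries.coeff_zero_eq_constantCoeff_apply, elemSeries, PowerSeries.coeff_mk,
    elemSymm_zero]
  simp

lemma sum_neg_one_pow_mul_elemSymm_mul_compSymm (n : ℕ) :
    ∑ k ∈ range (n + 1), (-1) ^ k * elemSymm l k * compSymm l (n - k) = if n = 0 then 1 else 0 := by
  have h := congrArg (PowerSeries.coeff n) (elemSeries_mul_mk_compSymm (l := l))
  rw [PowerSeries.coeff_mul, PowerSeries.coeff_one,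
    Nat.sum_antidiagonal_eq_sum_range_succ_mk] at h
  simpa [elemSeries, PowerSeries.coeff_mk] using h

lemma compSymm_zero : compSymm l 0 = 1 := by
  have h := sum_neg_one_pow_mul_elemSymm_mul_compSymm (l := l) 0
  simpa [elemSymm_zero] using h

lemma compSymm_isHomogeneous (n : ℕ) : (compSymm l n).IsHomogeneous n := by
  induction n using Nat.strong_induction_on with
  | _ n ih =>
    rcases n with _ | n
    · rw [compSymm_zero]; exact isHomogeneous_one _ _
    · have h := sum_neg_one_pow_mul_elemSymm_mul_compSymm (l := l) (n + 1)
      rw [sum_range_succ', if_neg (Nat.succ_ne_zero n)] at h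
      have h' : compSymm l (n + 1) =
          - ∑ k ∈ range (n + 1), (-1) ^ (k + 1) * elemSymm l (k + 1) * compSymm l (n - k) := by
        have h2 : ∀ k, n + 1 - (k + 1) = n - k := fun k => by omega
        simp only [h2, pow_zero, elemSymm_zero, Nat.sub_zero] at h
        linear_combination h
      rw [h']
      refine (IsHomogeneous.sum _ _ _ fun k hk => ?_).neg
      have hk' : k ≤ n := Nat.lt_succ_iff.1 (mem_range.1 hk)
      have h1 := ((elemSymm_isHomogeneous (l := l) (k + 1)).mul (ih (n - k) (by omega)))
      rw [show k + 1 + (n - k) = n + 1 by omega] at h1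
      have h3 : (-1 : MvPolynomial (Fin l) ℝ) ^ (k + 1) = C ((-1) ^ (k + 1)) := by simp
      rw [mul_assoc, h3]
      exact h1.C_mul _

/-- The coefficientwise partial derivative of a power series with polynomial coefficients. -/
def coeffPderiv (i : Fin l) (f : PowerSeries (MvPolynomial (Fin l) ℝ)) :
    PowerSeries (MvPolynomial (Fin l) ℝ) :=
  PowerSeries.mk fun n => pderiv i (PowerSeries.coeff n f)

lemma coeffPderiv_mul (i : Fin l) (f g : PowerSeries (MvPolynomial (Fin l) ℝ)) :
    coeffPderiv i (f * g) = coeffPderiv i f * g + f * coeffPderiv i g := by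
  ext1 n
  rw [map_add, coeffPderiv, PowerSeries.coeff_mk, PowerSeries.coeff_mul, PowerSeries.coeff_mul,
    PowerSeries.coeff_mul, map_sum, ← sum_add_distrib]
  refine sum_congr rfl fun p _ => ?_
  rw [coeffPderiv, coeffPderiv, PowerSeries.coeff_mk, PowerSeries.coeff_mk, Derivation.leibniz]
  simp only [smul_eq_mul]
  ring

/-- The series of the `e`'s factors as `(1 - Xᵢt) r` with `r` free of `Xᵢ`. Differentiating `E H =
1` and cancelling `r` leaves `(1 - Xᵢt) ∂ᵢH = t H`. -/
lemma pderiv_compSymm_succ (i : Fin l) (n : ℕ) :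
    pderiv i (compSymm l (n + 1)) = compSymm l n + X i * pderiv i (compSymm l n) := by
  set H := PowerSeries.mk (compSymm l) with hH
  set r : PowerSeries (MvPolynomial (Fin l) ℝ) :=
    PowerSeries.mk fun k => (-1) ^ k * pderiv i (elemSymm l (k + 1)) with hr
  have hE : elemSeries l = (1 - PowerSeries.C (X i) * PowerSeries.X) * r := by
    ext1 n
    rw [sub_mul, one_mul, map_sub, mul_assoc, PowerSeries.coeff_C_mul, elemSeries, hr,
      PowerSeries.coeff_mk, PowerSeries.coeff_mk]
    cases n with
    | zero =>
      rw [PowerSeries.coeff_zero_X_mul]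
      rw [elemSymm_zero]
      simp
    | succ n =>
      rw [PowerSeries.coeff_succ_X_mul, PowerSeries.coeff_mk]
      linear_combination (-1) ^ n * pderiv_elemSymm_succ_add i (n + 1)
  have hdE : coeffPderiv i (elemSeries l) = - (PowerSeries.X * r) := by
    ext1 n
    rw [map_neg, coeffPderiv, PowerSeries.coeff_mk, elemSeries, PowerSeries.coeff_mk, hr]
    have hc : (-1 : MvPolynomial (Fin l) ℝ) ^ n = C ((-1) ^ n) := by simp
    cases n with
    | zero => rw [PowerSeries.coeff_zero_X_mul, elemSymm_zero]; simp
    | succ n =>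
      rw [PowerSeries.coeff_succ_X_mul, PowerSeries.coeff_mk, hc, pderiv_C_mul, ← hc]
      ring
  have h1 := congrArg (coeffPderiv i) (elemSeries_mul_mk_compSymm (l := l))
  rw [coeffPderiv_mul, hdE, ← hH] at h1
  have h0 : coeffPderiv i (1 : PowerSeries (MvPolynomial (Fin l) ℝ)) = 0 := by
    ext1 n
    rw [coeffPderiv, PowerSeries.coeff_mk, PowerSeries.coeff_one, map_zero]
    split_ifs <;> simp
  rw [h0, hE] at h1
  have hrne : r ≠ 0 := fun h => by
    have := elemSeries_mul_mk_compSymm (l := l)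
    rw [hE, h] at this
    simp at this
  have h2 : (1 - PowerSeries.C (X i) * PowerSeries.X) * coeffPderiv i H = PowerSeries.X * H := by
    refine mul_left_cancel₀ hrne ?_
    linear_combination h1
  have h3 := congrArg (PowerSeries.coeff (n + 1)) h2
  rw [sub_mul, one_mul, map_sub, mul_assoc, PowerSeries.coeff_C_mul,
    PowerSeries.coeff_succ_X_mul, PowerSeries.coeff_succ_X_mul, coeffPderiv, PowerSeries.coeff_mk,
    PowerSeries.coeff_mk, hH, PowerSeries.coeff_mk, PowerSeries.coeff_mk] at h3
  linear_combination h3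

lemma sum_X_mul_pderiv_compSymm (k : ℕ) :
    ∑ i, X i * pderiv i (compSymm l k) = (k : MvPolynomial (Fin l) ℝ) * compSymm l k := by
  rw [(compSymm_isHomogeneous k).sum_X_mul_pderiv, nsmul_eq_mul]

/-! ### Schur polynomials of hooks -/

/-- The Schur polynomial of the hook `(m - j + 1, 1, …, 1)` with `j` rows. -/
def hookSchur (l m : ℕ) : ℕ → MvPolynomial (Fin l) ℝ
  | 0 => 0
  | j + 1 => elemSymm l j * compSymm l (m - j) - hookSchur l m j

/-- Pieri's rule: multiplying a column by a row yields exactly two hooks. -/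
lemma hookSchur_add_succ (m j : ℕ) :
    hookSchur l m j + hookSchur l m (j + 1) = elemSymm l j * compSymm l (m - j) := by
  rw [hookSchur]; ring

lemma hookSchur_eq_sum (m j : ℕ) : (-1) ^ j * hookSchur l m (j + 1) =
    ∑ k ∈ range (j + 1), (-1) ^ k * elemSymm l k * compSymm l (m - k) := by
  induction j with
  | zero => simp [hookSchur]
  | succ j ih => rw [sum_range_succ, ← ih, hookSchur]; ring

/-- The alternating sum is now the full coefficient of `E H = 1`. This is the boundary value from
which the hook relations are solved downwards in `j`. -/
lemma hookSchur_self_succ {m : ℕ} (hm : m ≠ 0) : hookSchur l m (m + 1) = 0 := by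
  have h := hookSchur_eq_sum (l := l) m m
  rw [sum_neg_one_pow_mul_elemSymm_mul_compSymm, if_neg hm] at h
  exact (mul_eq_zero.1 h).resolve_left (pow_ne_zero _ (by simp))

lemma hookSchur_self {m : ℕ} (hm : m ≠ 0) : hookSchur l m m = elemSymm l m := by
  have h := hookSchur_add_succ (l := l) m m
  rwa [hookSchur_self_succ hm, add_zero, Nat.sub_self, compSymm_zero, mul_one] at h

lemma hookSchur_isHomogeneous {m j : ℕ} (hj : j ≤ m + 1) :
    (hookSchur l m j).IsHomogeneous m := by
  induction j with
  | zero => exact isHomogeneous_zero _ _ _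
  | succ j ih =>
    have h := (elemSymm_isHomogeneous (l := l) j).mul (compSymm_isHomogeneous (m - j))
    rw [Nat.add_sub_cancel' (by omega)] at h
    exact h.sub (ih (by omega))

/-- Induction on `b` with `k` free: the derivative recurrences of `e` and `h` trade `(b + 1, k)` for
`(b, k + 1)` up to Euler terms. It evaluates the part of the loop equation where the derivative
falls on `h_k`. -/
lemma sum_X_sq_mul_pderiv_mul_pderiv (b k : ℕ) :
    ∑ i, X i ^ 2 * pderiv i (elemSymm l b) * pderiv i (compSymm l k) =
      (k : MvPolynomial (Fin l) ℝ) * hookSchur l (k + b) b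
        - (b : MvPolynomial (Fin l) ℝ) * hookSchur l (k + b) (b + 1) := by
  induction b generalizing k with
  | zero => simp [hookSchur]
  | succ b ih =>
    have h1 : ∑ i, X i ^ 2 * pderiv i (elemSymm l (b + 1)) * pderiv i (compSymm l k)
        + ∑ i, X i ^ 2 * pderiv i (elemSymm l b) * pderiv i (compSymm l (k + 1))
        = (∑ i, X i * pderiv i (compSymm l (k + 1))) * elemSymm l b
          - (∑ i, X i * pderiv i (elemSymm l (b + 1))) * compSymm l k := by
      rw [sum_mul, sum_mul, ← sum_add_distrib, ← sum_sub_distrib]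
      refine sum_congr rfl fun i _ => ?_
      rw [pderiv_compSymm_succ]
      linear_combination (X i * compSymm l k + X i ^ 2 * pderiv i (compSymm l k))
        * pderiv_elemSymm_succ_add i b
    rw [ih (k + 1), sum_X_mul_pderiv_elemSymm, sum_X_mul_pderiv_compSymm] at h1
    have e1 : k + 1 + b = k + (b + 1) := by ring
    have h2 := hookSchur_add_succ (l := l) (k + (b + 1)) b
    have h3 := hookSchur_add_succ (l := l) (k + (b + 1)) (b + 1)
    rw [show k + (b + 1) - b = k + 1 by omega] at h2
    rw [show k + (b + 1) - (b + 1) = k by omega] at h3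
    rw [e1] at h1
    push_cast at h1 ⊢
    linear_combination h1 - ((k : MvPolynomial (Fin l) ℝ) + 1) * h2
      + ((b : MvPolynomial (Fin l) ℝ) + 1) * h3

end

section

open MvPolynomial Finset

variable {l : ℕ}

/-! ### The functional with given moments in every variable -/

/-- The linear functional on polynomials in `l` variables with moments `μ` in every variable. -/
def momentFunctional (l : ℕ) (μ : ℕ → ℝ) : MvPolynomial (Fin l) ℝ →ₗ[ℝ] ℝ :=
  (basisMonomials (Fin l) ℝ).constr ℝ fun d => ∏ i, μ (d i)

lemma momentFunctional_monomial (μ : ℕ → ℝ) (d : Fin l →₀ ℕ) (c : ℝ) :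
    momentFunctional l μ (monomial d c) = c * ∏ i, μ (d i) := by
  have h : (monomial d c : MvPolynomial (Fin l) ℝ) = c • basisMonomials (Fin l) ℝ d := by
    rw [coe_basisMonomials, smul_monomial, smul_eq_mul, mul_one]
  rw [h, map_smul, momentFunctional, Module.Basis.constr_basis, smul_eq_mul]

lemma momentFunctional_C_mul (μ : ℕ → ℝ) (c : ℝ) (p : MvPolynomial (Fin l) ℝ) :
    momentFunctional l μ (C c * p) = c * momentFunctional l μ p := by
  rw [← smul_eq_C_mul, map_smul, smul_eq_mul]

lemma momentFunctional_X_pow_mul_monomial (μ : ℕ → ℝ) (d : Fin l →₀ ℕ) (c : ℝ) (i : Fin l)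
    (n : ℕ) : momentFunctional l μ (X i ^ n * monomial d c) =
      c * (μ (d i + n) * ∏ j ∈ univ.erase i, μ (d j)) := by
  rw [X_pow_eq_monomial, monomial_mul, one_mul, momentFunctional_monomial,
    ← mul_prod_erase univ _ (mem_univ i)]
  congr 2
  · simp [add_comm]
  · refine prod_congr rfl fun j hj => ?_
    simp [Finsupp.single_eq_of_ne (ne_of_mem_erase hj)]

lemma momentFunctional_prod_X_pow (μ : ℕ → ℝ) (f : Fin l → ℕ) :
    momentFunctional l μ (∏ i, X i ^ f i) = ∏ i, μ (f i) := by
  have h : (∏ i, (X i : MvPolynomial (Fin l) ℝ) ^ f i)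
      = monomial (Finsupp.equivFunOnFinite.symm f) 1 := by
    rw [monomial_eq, map_one, one_mul, Finsupp.prod_fintype _ _ fun i => pow_zero _]
    rfl
  rw [h, momentFunctional_monomial, one_mul]
  rfl

/-- Integration by parts: the three-term recurrence of the moments. -/
lemma momentFunctional_integration_by_parts {μ : ℕ → ℝ} {α s : ℝ}
    (hμ : ∀ n : ℕ, ((n : ℝ) + α + 1) * μ (n + 1) + s * (μ (n + 2) - μ n) = 0)
    (i : Fin l) (p : MvPolynomial (Fin l) ℝ) :
    momentFunctional l μ (X i ^ 2 * pderiv i p + C (α + 1) * (X i * p)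
      + C s * (X i ^ 2 * p - p)) = 0 := by
  induction p using MvPolynomial.induction_on' with
  | monomial d c =>
    -- On a monomial the derivative produces the exponent `d i`, so the expression becomes the
    -- moment recurrence at `n = d i`.
    have h : (X i : MvPolynomial (Fin l) ℝ) ^ 2 * pderiv i (monomial d c)
        = C (d i : ℝ) * (X i ^ 1 * monomial d c) := by
      have := X_mul_pderiv_monomial (R := ℝ) (i := i) (m := d) (r := c)
      rw [sq, mul_assoc, this, nsmul_eq_mul]
      simp only [map_natCast]
      ring
    have h0 := momentFunctional_X_pow_mul_monomial μ d c i 0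
    have h1 := momentFunctional_X_pow_mul_monomial μ d c i 1
    rw [pow_zero, one_mul] at h0
    rw [pow_one] at h h1
    rw [map_add, map_add, h, momentFunctional_C_mul, momentFunctional_C_mul,
      momentFunctional_C_mul, map_sub, h0, h1, momentFunctional_X_pow_mul_monomial]
    linear_combination (c * ∏ j ∈ univ.erase i, μ (d j)) * hμ (d i)
  | add p q hp hq =>
    have : X i ^ 2 * pderiv i (p + q) + C (α + 1) * (X i * (p + q))
      + C s * (X i ^ 2 * (p + q) - (p + q)) =
      (X i ^ 2 * pderiv i p + C (α + 1) * (X i * p) + C s * (X i ^ 2 * p - p))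
      + (X i ^ 2 * pderiv i q + C (α + 1) * (X i * q) + C s * (X i ^ 2 * q - q)) := by
      rw [map_add]; ring
    rw [this, map_add, hp, hq, add_zero]

/-- Product rule on a monomial: raising one moment index is multiplication by `Xᵢ`, and the weights
`d i + α` add up to the Euler operator plus `l α`. -/
lemma hasDerivAt_momentFunctional {μ : ℕ → ℝ → ℝ} {α s x : ℝ}
    (hμ : ∀ n : ℕ, HasDerivAt (μ n) (μ (n + 1) x / s + ((n : ℝ) + α) / (2 * x) * μ n x) x)
    (p : MvPolynomial (Fin l) ℝ) :
    HasDerivAt (fun y => momentFunctional l (fun n => μ n y) p)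
      (momentFunctional l (fun n => μ n x) ((∑ i, X i) * p) / s
        + (momentFunctional l (fun n => μ n x) (∑ i, X i * pderiv i p)
          + l * α * momentFunctional l (fun n => μ n x) p) / (2 * x)) x := by
  induction p using MvPolynomial.induction_on' with
  | monomial d c =>
    simp only [momentFunctional_monomial]
    refine ((HasDerivAt.fun_finsetProd fun i _ => hμ (d i)).const_mul c).congr_deriv ?_
    have h1 : ∀ i : Fin l, momentFunctional l (fun n => μ n x) (X i * monomial d c) =
        c * (μ (d i + 1) x * ∏ j ∈ univ.erase i, μ (d j) x) := fun i => by
      have := momentFunctional_X_pow_mul_monomial (fun n => μ n x) d c i 1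
      rwa [pow_one] at this
    have h2 : ∀ i : Fin l, momentFunctional l (fun n => μ n x) (X i * pderiv i (monomial d c)) =
        (d i : ℝ) * (c * (μ (d i) x * ∏ j ∈ univ.erase i, μ (d j) x)) := fun i => by
      rw [X_mul_pderiv_monomial, map_nsmul, momentFunctional_monomial, nsmul_eq_mul,
        mul_prod_erase univ (fun j => μ (d j) x) (mem_univ i)]
    have h3 : (l : ℝ) * α * (c * ∏ i, μ (d i) x) =
        ∑ i : Fin l, α * (c * (μ (d i) x * ∏ j ∈ univ.erase i, μ (d j) x)) := by
      simp_rw [fun i : Fin l => mul_prod_erase univ (fun j => μ (d j) x) (mem_univ i)]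
      rw [sum_const, card_univ, Fintype.card_fin, nsmul_eq_mul]
      ring
    rw [h3, sum_mul, map_sum, map_sum]
    simp_rw [h1, h2]
    rw [← sum_add_distrib, sum_div, sum_div, ← sum_add_distrib, mul_sum]
    refine sum_congr rfl fun i _ => ?_
    rw [smul_eq_mul]
    ring
  | add p q hp hq =>
    simp only [map_add, mul_add, sum_add_distrib]
    exact (hp.add hq).congr_deriv (by ring)

/-! ### The Vandermonde determinant -/

/-- The Vandermonde determinant of the variables. -/
def vand (l : ℕ) : MvPolynomial (Fin l) ℝ :=
  (Matrix.vandermonde (X : Fin l → MvPolynomial (Fin l) ℝ)).det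

/-- Expand both Vandermonde determinants over permutations `σ`, `π`. The value depends only on `π *
σ⁻¹`, so each of the `l!` choices of `σ` contributes one Hankel determinant. -/
lemma momentFunctional_vand_sq (μ : ℕ → ℝ) :
    momentFunctional l μ (vand l ^ 2) =
      (l ! : ℝ) * (Matrix.of fun j k : Fin l => μ (j + k)).det := by
  have hv : vand l = ∑ σ : Equiv.Perm (Fin l),
      ((Equiv.Perm.sign σ : ℤ) : MvPolynomial (Fin l) ℝ) * ∏ i, X i ^ (σ i : ℕ) := by
    rw [vand, ← Matrix.det_transpose, Matrix.det_apply']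
    rfl
  have hterm : ∀ σ π : Equiv.Perm (Fin l), momentFunctional l μ
      ((((Equiv.Perm.sign σ : ℤ) : MvPolynomial (Fin l) ℝ) * ∏ i, X i ^ (σ i : ℕ)) *
      (((Equiv.Perm.sign π : ℤ) : MvPolynomial (Fin l) ℝ) * ∏ i, X i ^ (π i : ℕ))) =
      ((Equiv.Perm.sign (π * σ⁻¹) : ℤ) : ℝ) * ∏ i : Fin l, μ ((i : ℕ) + ((π * σ⁻¹) i : ℕ)) := by
    intro σ π
    have h1 : (((Equiv.Perm.sign σ : ℤ) : MvPolynomial (Fin l) ℝ) * ∏ i, X i ^ (σ i : ℕ)) *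
      (((Equiv.Perm.sign π : ℤ) : MvPolynomial (Fin l) ℝ) * ∏ i, X i ^ (π i : ℕ)) =
      C (((Equiv.Perm.sign σ : ℤ) : ℝ) * ((Equiv.Perm.sign π : ℤ) : ℝ))
        * ∏ i, X i ^ ((σ i : ℕ) + (π i : ℕ)) := by
      simp_rw [pow_add]
      rw [prod_mul_distrib, map_mul]
      simp only [map_intCast]
      ring
    rw [h1, momentFunctional_C_mul, momentFunctional_prod_X_pow]
    congr 1
    · rw [Equiv.Perm.sign_mul, Equiv.Perm.sign_inv]
      push_cast
      ring
    · rw [← Equiv.prod_comp σ (fun i : Fin l => μ ((i : ℕ) + ((π * σ⁻¹) i : ℕ)))]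
      simp
  rw [hv, sq, sum_mul_sum, map_sum]
  simp_rw [map_sum, hterm]
  have hin : ∀ σ : Equiv.Perm (Fin l), ∑ π : Equiv.Perm (Fin l),
      ((Equiv.Perm.sign (π * σ⁻¹) : ℤ) : ℝ) * ∏ i : Fin l, μ ((i : ℕ) + ((π * σ⁻¹) i : ℕ)) =
      (Matrix.of fun j k : Fin l => μ (j + k)).det := fun σ => by
    refine (Equiv.sum_comp (Equiv.mulRight σ⁻¹) (fun ρ : Equiv.Perm (Fin l) =>
      ((Equiv.Perm.sign ρ : ℤ) : ℝ) * ∏ i : Fin l, μ ((i : ℕ) + (ρ i : ℕ)))).trans ?_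
    rw [← Matrix.det_transpose, Matrix.det_apply']
    rfl
  simp_rw [hin]
  rw [sum_const, card_univ, Fintype.card_perm, Fintype.card_fin, nsmul_eq_mul]

lemma Derivation.prod_eq_mul_sum {ι A : Type*} [CommRing A] [Algebra ℝ A]
    (D : Derivation ℝ A A) (f q : ι → A) (s : Finset ι) (h : ∀ i ∈ s, D (f i) = f i * q i) :
    D (∏ i ∈ s, f i) = (∏ i ∈ s, f i) * ∑ i ∈ s, q i := by
  classical
  induction s using Finset.induction_on with
  | empty => simp
  | insert a s ha ih =>
    rw [prod_insert ha, sum_insert ha, Derivation.leibniz, h a (mem_insert_self a s),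
      ih fun i hi => h i (mem_insert_of_mem hi)]
    simp only [smul_eq_mul]
    ring

lemma sum_sum_Ioi_eq {A : Type*} [CommRing A] (q : Fin l → Fin l → A)
    (hq : ∀ i j, q i j = q j i) :
    2 * ∑ i, ∑ j ∈ Ioi i, q i j = ∑ i, ∑ j, q i j - ∑ i, q i i := by
  have h1 : ∑ i, ∑ j ∈ Iio i, q i j = ∑ i, ∑ j ∈ Ioi i, q i j := by
    rw [sum_comm' (t' := univ) (s' := fun j => Ioi j) (by simp)]
    exact sum_congr rfl fun i _ => sum_congr rfl fun j _ => hq _ _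
  have h2 : ∀ i : Fin l, ∑ j, q i j = ∑ j ∈ Ioi i, q i j + ∑ j ∈ Iio i, q i j + q i i := by
    intro i
    have hu : (univ : Finset (Fin l)) = (Ioi i ∪ Iio i) ∪ {i} := by
      ext j
      simp only [mem_univ, mem_union, mem_Ioi, mem_Iio, mem_singleton, true_iff]
      rcases lt_trichotomy i j with h | h | h <;> simp [h]
    rw [hu, sum_union, sum_union, sum_singleton]
    · rw [disjoint_left]; intro j h1 h2
      exact lt_asymm (mem_Ioi.1 h1) (mem_Iio.1 h2)
    · simp
  rw [sum_congr rfl fun i _ => h2 i, sum_add_distrib, sum_add_distrib, h1]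
  ring

/-- The divided difference `q i j` is the logarithmic derivative of the factor for the pair `i`,
`j`. Squaring counts each pair twice, giving the sum over all ordered off-diagonal pairs. -/
lemma mkDerivation_vand_sq (y : Fin l → MvPolynomial (Fin l) ℝ)
    (q : Fin l → Fin l → MvPolynomial (Fin l) ℝ) (hq : ∀ i j, q i j = q j i)
    (h : ∀ i j, y i - y j = (X i - X j) * q i j) :
    mkDerivation ℝ y (vand l ^ 2) = vand l ^ 2 * (∑ i, ∑ j, q i j - ∑ i, q i i) := by
  have hD : mkDerivation ℝ y (vand l) = vand l * ∑ i, ∑ j ∈ Ioi i, q i j := by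
    rw [vand, Matrix.det_vandermonde]
    refine Derivation.prod_eq_mul_sum _ _ _ _ fun i _ => ?_
    refine Derivation.prod_eq_mul_sum _ _ _ _ fun j _ => ?_
    rw [map_sub, mkDerivation_X, mkDerivation_X, h, hq]
  rw [Derivation.leibniz_pow, hD, ← sum_sum_Ioi_eq q hq]
  simp only [smul_eq_mul, nsmul_eq_mul]
  push_cast
  ring

lemma mkDerivation_eq_sum (y : Fin l → MvPolynomial (Fin l) ℝ) (p : MvPolynomial (Fin l) ℝ) :
    mkDerivation ℝ y p = ∑ i, y i * pderiv i p := by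
  induction p using MvPolynomial.induction_on with
  | C a => simp
  | add p q hp hq => simp only [map_add, hp, hq, mul_add, sum_add_distrib]
  | mul_X p j hp =>
    have h : ∑ i, y i * pderiv i (X j : MvPolynomial (Fin l) ℝ) = y j := by
      rw [sum_eq_single j]
      · simp
      · intro i _ hij
        simp [pderiv_X_of_ne hij.symm]
      · simp
    simp only [Derivation.leibniz, mkDerivation_X, hp, smul_eq_mul, mul_add, sum_add_distrib]
    rw [← h, mul_sum, mul_sum]
    congr 1 <;> exact sum_congr rfl fun i _ => by ring

lemma sum_X_mul_pderiv_vand_sq :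
    ∑ i, X i * pderiv i (vand l ^ 2) = ((l : MvPolynomial (Fin l) ℝ) * (l - 1)) * vand l ^ 2 := by
  rw [← mkDerivation_eq_sum, mkDerivation_vand_sq _ (fun _ _ => 1) (fun _ _ => rfl)
    fun i j => (mul_one _).symm]
  simp only [sum_const, card_univ, Fintype.card_fin, nsmul_eq_mul, mul_one]
  ring

end

section

open MvPolynomial Finset

variable {l : ℕ}

/-! ### Loop equation for hooks -/

lemma pderiv_pderiv_comm (i j : Fin l) (p : MvPolynomial (Fin l) ℝ) :
    pderiv i (pderiv j p) = pderiv j (pderiv i p) := by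
  have h : ⁅pderiv (R := ℝ) i, pderiv (R := ℝ) j⁆ = 0 := by
    refine MvPolynomial.derivation_ext fun k => ?_
    simp only [Derivation.commutator_apply, pderiv_X, Pi.single_apply]
    split_ifs <;> simp
  have h' : ⁅pderiv (R := ℝ) i, pderiv (R := ℝ) j⁆ p = 0 := by rw [h, Derivation.zero_apply]
  rw [Derivation.commutator_apply] at h'
  exact sub_eq_zero.1 h'

/-- Apply `∂ⱼ` to the recurrence for `∂ᵢ` and `∂ᵢ` to that for `∂ⱼ`, then subtract: the terms in
`e_{n+1}` cancel. It supplies the divided difference needed in `mkDerivation_vand_sq`. -/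
lemma sub_mul_pderiv_pderiv_elemSymm (i j : Fin l) (n : ℕ) :
    (X i - X j) * pderiv i (pderiv j (elemSymm l n)) =
      pderiv j (elemSymm l n) - pderiv i (elemSymm l n) := by
  rcases eq_or_ne i j with rfl | hij
  · simp
  have hc : pderiv j (pderiv i (elemSymm l n)) = pderiv i (pderiv j (elemSymm l n)) :=
    pderiv_pderiv_comm _ _ _
  have hc' : pderiv j (pderiv i (elemSymm l (n + 1)))
      = pderiv i (pderiv j (elemSymm l (n + 1))) :=
    pderiv_pderiv_comm _ _ _
  have h1 := congrArg (pderiv j) (pderiv_elemSymm_succ_add i n)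
  have h2 := congrArg (pderiv i) (pderiv_elemSymm_succ_add j n)
  rw [map_add, Derivation.leibniz, pderiv_X_of_ne hij, hc, hc'] at h1
  rw [map_add, Derivation.leibniz, pderiv_X_of_ne hij.symm] at h2
  simp only [smul_eq_mul, mul_zero, add_zero] at h1 h2
  linear_combination h1 - h2

lemma sum_sum_pderiv_pderiv_elemSymm (n : ℕ) :
    ∑ i, ∑ j, pderiv i (pderiv j (elemSymm l (n + 2))) =
      ((l : MvPolynomial (Fin l) ℝ) - n) * ((l : MvPolynomial (Fin l) ℝ) - (n + 1))
        * elemSymm l n := by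
  have h : ∀ i : Fin l, ∑ j, pderiv i (pderiv j (elemSymm l (n + 2))) =
      ((l : MvPolynomial (Fin l) ℝ) - (n + 1)) * pderiv i (elemSymm l (n + 1)) := fun i => by
    rw [← map_sum, sum_pderiv_elemSymm]
    have hC : ((l : MvPolynomial (Fin l) ℝ) - ((n + 1 : ℕ) : MvPolynomial (Fin l) ℝ))
        = C ((l : ℝ) - (n + 1)) := by simp
    rw [hC, pderiv_C_mul, C_mul', ← C_mul', ← hC]
    push_cast
    ring
  rw [sum_congr rfl fun i _ => h i, ← mul_sum, sum_pderiv_elemSymm]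
  ring

/-- The derivative meets three factors: `Δ²` (evaluated in `hD`), `∂ᵢe_{b+1}` (no contribution,
since `e` is affine in each variable) and `h_k` (evaluated in `hQ`). The terms in `s` are lowered by
the recurrence for `∂ᵢe`. -/
lemma sum_loop_equation (α s : ℝ) (b k : ℕ) :
    ∑ i, (X i ^ 2 * pderiv i (vand l ^ 2 * (pderiv i (elemSymm l (b + 1)) * compSymm l k))
      + C (α + 1) * (X i * (vand l ^ 2 * (pderiv i (elemSymm l (b + 1)) * compSymm l k)))
      + C s * (X i ^ 2 * (vand l ^ 2 * (pderiv i (elemSymm l (b + 1)) * compSymm l k))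
        - vand l ^ 2 * (pderiv i (elemSymm l (b + 1)) * compSymm l k))) =
    C s * (vand l ^ 2 * ((∑ i, X i) * (elemSymm l (b + 1) * compSymm l k)))
      + C (-s * (b + 2)) * (vand l ^ 2 * (elemSymm l (b + 2) * compSymm l k))
      + C (-s * (l - b)) * (vand l ^ 2 * (elemSymm l b * compSymm l k))
      + C ((b + 1) * (2 * l - (b + 1) + α)) * (vand l ^ 2 * (elemSymm l (b + 1) * compSymm l k))
      + C (k : ℝ) * (vand l ^ 2 * hookSchur l (k + (b + 1)) (b + 1))
      + C (-(b + 1) : ℝ) * (vand l ^ 2 * hookSchur l (k + (b + 1)) (b + 2)) := by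
  set V := vand l ^ 2 with hV
  set h := compSymm l k with hh
  have hD : ∑ i, (X i ^ 2 * pderiv i (elemSymm l (b + 1)) * h) * pderiv i V =
      V * ((((l : MvPolynomial (Fin l) ℝ) * (l - 1)) - (l - (b + 1)) * (l - (b + 2)))
        * (elemSymm l (b + 1) * h)) := by
    rw [← mkDerivation_eq_sum, hV, mkDerivation_vand_sq _
      -- Two uses of the recurrence give `Xᵢ² ∂ᵢe_{b+1} = Xᵢ e_{b+1} - e_{b+2} + ∂ᵢe_{b+3}`; the
      -- middle term drops out of the difference.
      (fun i j => (elemSymm l (b + 1) - pderiv i (pderiv j (elemSymm l (b + 3)))) * h)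
      (fun i j => by rw [pderiv_pderiv_comm i j]) (fun i j => ?_)]
    · congr 1
      have h1 := sum_sum_pderiv_pderiv_elemSymm (l := l) (b + 1)
      simp only [← sum_mul, sum_sub_distrib, sum_const, card_univ, Fintype.card_fin,
        nsmul_eq_mul, pderiv_pderiv_elemSymm, h1]
      push_cast
      ring
    · have e1 := pderiv_elemSymm_succ_add i (b + 1)
      have e2 := pderiv_elemSymm_succ_add i (b + 2)
      have f1 := pderiv_elemSymm_succ_add j (b + 1)
      have f2 := pderiv_elemSymm_succ_add j (b + 2)
      have g := sub_mul_pderiv_pderiv_elemSymm i j (b + 3)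
      linear_combination h * (X i * e1 - e2 - X j * f1 + f2 + g)
  have hQ := sum_X_sq_mul_pderiv_mul_pderiv (l := l) (b + 1) k
  have hX := sum_X_mul_pderiv_elemSymm (l := l) (b + 1)
  have hX2 := sum_X_mul_pderiv_elemSymm (l := l) (b + 2)
  have hS := sum_pderiv_elemSymm (l := l) b
  have hterm : ∀ i : Fin l,
      X i ^ 2 * pderiv i (V * (pderiv i (elemSymm l (b + 1)) * h))
      + C (α + 1) * (X i * (V * (pderiv i (elemSymm l (b + 1)) * h)))
      + C s * (X i ^ 2 * (V * (pderiv i (elemSymm l (b + 1)) * h))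
        - V * (pderiv i (elemSymm l (b + 1)) * h)) =
      (X i ^ 2 * pderiv i (elemSymm l (b + 1)) * h) * pderiv i V
      + V * (X i ^ 2 * pderiv i (elemSymm l (b + 1)) * pderiv i h)
      + (C (α + 1) * V * h) * (X i * pderiv i (elemSymm l (b + 1)))
      + (C s * V * h) * (X i * elemSymm l (b + 1) - X i * pderiv i (elemSymm l (b + 2))
        - pderiv i (elemSymm l (b + 1))) := fun i => by
    rw [Derivation.leibniz, Derivation.leibniz, pderiv_pderiv_elemSymm]
    simp only [smul_eq_mul]
    linear_combination (C s * V * h * X i) * pderiv_elemSymm_succ_add i (b + 1)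
  rw [sum_congr rfl fun i _ => hterm i, sum_add_distrib, sum_add_distrib, sum_add_distrib,
    ← mul_sum, ← mul_sum, ← mul_sum, sum_sub_distrib, sum_sub_distrib, hD, hQ, hX, hX2, hS,
    ← sum_mul]
  simp only [map_neg, map_add, map_sub, map_mul, map_natCast, map_one, map_ofNat]
  push_cast
  ring

/-! ### Averages against the squared Vandermonde determinant -/

/-- The moments `I_{n+α}(2√x)`. -/
def besselMoment (α : ℝ) (n : ℕ) (x : ℝ) : ℝ := besselI ((n : ℝ) + α) (2 * √x)

/-- The average of a polynomial against the squared Vandermonde determinant. -/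
def average (l : ℕ) (α : ℝ) (p : MvPolynomial (Fin l) ℝ) (x : ℝ) : ℝ :=
  momentFunctional l (fun n => besselMoment α n x) (vand l ^ 2 * p) / l !

variable {α x : ℝ}

lemma hasDerivAt_besselMoment (hα : 0 ≤ α) (hx : 0 < x) (n : ℕ) :
    HasDerivAt (besselMoment α n) (besselMoment α (n + 1) x / √x
      + ((n : ℝ) + α) / (2 * x) * besselMoment α n x) x := by
  have h := hasDerivAt_besselI_two_mul_sqrt (ν := (n : ℝ) + α) (by positivity) hx
  rw [show (n : ℝ) + α + 1 = ((n + 1 : ℕ) : ℝ) + α by push_cast; ring] at h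
  exact h

lemma average_add (p q : MvPolynomial (Fin l) ℝ) :
    average l α (p + q) x = average l α p x + average l α q x := by
  rw [average, mul_add, map_add, add_div]; rfl

lemma average_zero : average l α 0 x = 0 := by
  rw [average, mul_zero, map_zero, zero_div]

lemma average_one : average l α 1 x = tau l α x := by
  have h0 : ((l ! : ℕ) : ℝ) ≠ 0 := by exact_mod_cast Nat.factorial_ne_zero l
  rw [average, mul_one, momentFunctional_vand_sq, mul_div_cancel_left₀ _ h0, tau]
  simp only [besselMoment, Nat.cast_add]

lemma hasDerivAt_average (hα : 0 ≤ α) (hx : 0 < x) {p : MvPolynomial (Fin l) ℝ} {m : ℕ}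
    (hp : p.IsHomogeneous m) :
    HasDerivAt (average l α p) (average l α ((∑ i, X i) * p) x / √x
      + ((l : ℝ) ^ 2 + l * (α - 1) + m) / (2 * x) * average l α p x) x := by
  have h := (hasDerivAt_momentFunctional (hasDerivAt_besselMoment hα hx) (vand l ^ 2 * p)).div_const ((l ! : ℕ) : ℝ)
  refine HasDerivAt.congr_deriv (f := average l α p) h ?_
  -- `Δ² p` has degree `l(l-1) + m`; adding `l α` gives the constant `l² + l(α-1) + m`.
  have he : ∑ i, X i * pderiv i (vand l ^ 2 * p) =
      C ((l : ℝ) * (l - 1) + m) * (vand l ^ 2 * p) := by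
    have h1 := sum_X_mul_pderiv_vand_sq (l := l)
    have h2 := hp.sum_X_mul_pderiv
    rw [nsmul_eq_mul] at h2
    have h3 : ∀ i : Fin l, X i * pderiv i (vand l ^ 2 * p) =
        (X i * pderiv i (vand l ^ 2)) * p + vand l ^ 2 * (X i * pderiv i p) := fun i => by
      rw [Derivation.leibniz]
      simp only [smul_eq_mul]
      ring
    rw [sum_congr rfl fun i _ => h3 i, sum_add_distrib, ← sum_mul, ← mul_sum, h1, h2]
    simp only [map_add, map_sub, map_mul, map_natCast, map_one]
    ring
  rw [he, momentFunctional_C_mul, average, average,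
    show vand l ^ 2 * ((∑ i, X i) * p) = (∑ i, X i) * (vand l ^ 2 * p) by ring]
  ring

lemma average_loop_equation (hα : 0 ≤ α) (hx : 0 < x) (b k : ℕ) :
    √x * (average l α ((∑ i, X i) * (elemSymm l (b + 1) * compSymm l k)) x
        - (b + 2) * average l α (elemSymm l (b + 2) * compSymm l k) x
        - (l - b) * average l α (elemSymm l b * compSymm l k) x)
      + (b + 1) * (2 * l - (b + 1) + α) * average l α (elemSymm l (b + 1) * compSymm l k) x
      + k * average l α (hookSchur l (k + (b + 1)) (b + 1)) x
      - (b + 1) * average l α (hookSchur l (k + (b + 1)) (b + 2)) x = 0 := by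
  have hφ : ∀ n : ℕ, ((n : ℝ) + α + 1) * besselMoment α (n + 1) x
      + √x * (besselMoment α (n + 2) x - besselMoment α n x) = 0 := fun n => by
    have h := besselI_three_term (ν := (n : ℝ) + α) (by positivity) hx
    rw [show (n : ℝ) + α + 2 = ((n + 2 : ℕ) : ℝ) + α by push_cast; ring] at h
    rw [besselMoment, besselMoment, besselMoment,
      show ((n + 1 : ℕ) : ℝ) + α = (n : ℝ) + α + 1 by push_cast; ring]
    exact h
  have h := congrArg (momentFunctional l fun n => besselMoment α n x)
    (sum_loop_equation (l := l) α (√x) b k)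
  rw [map_sum, sum_eq_zero fun i _ => momentFunctional_integration_by_parts hφ i _] at h
  simp only [map_add, momentFunctional_C_mul] at h
  simp only [average]
  linear_combination (-1 / (l ! : ℝ)) * h

end

section

open MvPolynomial Finset

variable {l : ℕ} {α x : ℝ}

/-! ### Smoothness of the Hankel determinant -/

/-- Induction on `N` for all orders at once, because the derivative of moment `n` involves moment `n
+ 1`. -/
lemma contDiffOn_besselMoment (hα : 0 ≤ α) (N n : ℕ) :
    ContDiffOn ℝ N (besselMoment α n) (Set.Ioi 0) := by
  induction N generalizing n with
  | zero =>
    rw [Nat.cast_zero, contDiffOn_zero]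
    exact fun x hx => (hasDerivAt_besselMoment hα hx n).continuousAt.continuousWithinAt
  | succ N ih =>
    rw [Nat.cast_succ, contDiffOn_succ_iff_deriv_of_isOpen isOpen_Ioi]
    refine ⟨fun x hx =>
      (hasDerivAt_besselMoment hα hx n).differentiableAt.differentiableWithinAt,
      fun h => absurd h (by simp), ?_⟩
    have h : ContDiffOn ℝ N (fun x => besselMoment α (n + 1) x / √x
        + ((n : ℝ) + α) / (2 * x) * besselMoment α n x) (Set.Ioi 0) := by
      refine ((ih (n + 1)).div ?_ ?_).add ((contDiffOn_const.div ?_ ?_).mul (ih n))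
      · exact contDiffOn_id.sqrt fun x hx => (Set.mem_Ioi.1 hx).ne'
      · exact fun x hx => (Real.sqrt_pos.2 hx).ne'
      · exact contDiffOn_const.mul contDiffOn_id
      · exact fun x hx => mul_ne_zero two_ne_zero (Set.mem_Ioi.1 hx).ne'
    exact h.congr fun x hx => (hasDerivAt_besselMoment hα hx n).deriv

lemma contDiffOn_tau (l : ℕ) (hα : 0 ≤ α) : ContDiffOn ℝ ∞ (tau l α) (Set.Ioi 0) := by
  have hm : ∀ n, ContDiffOn ℝ ∞ (besselMoment α n) (Set.Ioi 0) := fun n =>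
    contDiffOn_infty.2 fun N => contDiffOn_besselMoment hα N n
  have h : tau l α = fun x => ∑ σ : Equiv.Perm (Fin l), ((Equiv.Perm.sign σ : ℤ) : ℝ) *
      ∏ i : Fin l, besselMoment α ((σ i : ℕ) + (i : ℕ)) x := by
    funext x
    rw [tau, Matrix.det_apply']
    simp only [Matrix.of_apply, besselMoment, Nat.cast_add]
  rw [h]
  exact ContDiffOn.sum fun σ _ => contDiffOn_const.mul (contDiffOn_prod fun i _ => hm _)

/-! ### The recursion matrices -/

/-- For `k > i + 1` the alternating signs cancel between adjacent rows, so only `k = i` and `k = i +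
1` survive. With its analogues for `C₁` and `C₂`, this turns the matrix recursion into a local
relation. -/
lemma matB_add_matB (n i k : ℕ) (hk : 1 ≤ k) (hkn : k ≤ n) :
    ((i : ℝ) + 1) * (matB (n + 1) (i + 1) k + matB (n + 1) (i + 2) k) =
      (if k = i + 1 then -1 else 0) + (if k = i then -1 else 0) := by
  have hk0 : (k : ℝ) ≠ 0 := by positivity
  have hi0 : (i : ℝ) + 1 ≠ 0 := by positivity
  rw [matB, matB, if_neg (by omega : ¬ k = n + 1), if_neg (by omega : ¬ k = n + 1)]
  rcases lt_trichotomy k (i + 1) with h | rfl | h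
  · rw [if_neg (by omega), if_neg (by omega : ¬ i + 2 ≤ k), if_neg (by omega : ¬ k + 1 = i + 2),
      if_neg (by omega : ¬ k = i + 1)]
    by_cases hki : k = i
    · subst hki
      simp only [if_true]
      push_cast
      field_simp
      ring
    · rw [if_neg (by omega), if_neg hki]
      ring
  · rw [if_pos le_rfl, if_neg (by omega), if_pos rfl, if_pos rfl, if_neg (by omega),
      show i + 1 + (i + 1) - 1 = 2 * i + 1 by omega, pow_succ, pow_mul]
    push_cast
    have hi1 : (i : ℝ) + 2 ≠ 0 := by positivity
    have hi2 : (i : ℝ) + 1 + 1 ≠ 0 := by positivity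
    norm_num
    field_simp
    ring
  · rw [if_pos (by omega), if_pos (by omega), if_neg (by omega), if_neg (by omega),
      show i + 1 + k - 1 = i + k by omega, show i + 2 + k - 1 = i + k + 1 by omega, pow_succ]
    ring

lemma matC₁_add_matC₁ (l : ℕ) (α : ℝ) (n i k : ℕ) (hk : 1 ≤ k) :
    ((i : ℝ) + 1) * (matC₁ l α (n + 1) (i + 1) k + matC₁ l α (n + 1) (i + 2) k) =
      (if k = i + 1 then -((i : ℝ) * (2 * l - i - 1 + α)) else 0)
        + (if k = i then -((i : ℝ) * (2 * l - i + α) + n - i) else 0) := by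
  have hk0 : (k : ℝ) ≠ 0 := by positivity
  have hi0 : (i : ℝ) + 1 ≠ 0 := by positivity
  rw [matC₁, matC₁]
  rcases lt_trichotomy k (i + 1) with h | rfl | h
  · rw [if_neg (by omega), if_neg (by omega : ¬ i + 2 ≤ k), if_neg (by omega : ¬ k + 1 = i + 2),
      if_neg (by omega : ¬ k = i + 1)]
    by_cases hki : k = i
    · subst hki
      simp only [if_true]
      push_cast
      field_simp
      ring
    · rw [if_neg (by omega), if_neg hki]
      ring
  · rw [if_pos le_rfl, if_neg (by omega), if_pos rfl, if_pos rfl, if_neg (by omega),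
      ← two_mul, pow_mul]
    push_cast
    have hi2 : (i : ℝ) + 1 + 1 ≠ 0 := by positivity
    norm_num
    field_simp
    ring
  · rw [if_pos (by omega), if_pos (by omega), if_neg (by omega), if_neg (by omega),
      show i + 2 + k = i + 1 + k + 1 by omega, pow_succ]
    ring

lemma matC₂_add_matC₂ (l i k : ℕ) :
    ((i : ℝ) + 1) * (matC₂ l (i + 1) k + matC₂ l (i + 2) k) =
      (if k = i then -((l : ℝ) - i + 1) else 0)
        + (if k + 1 = i then -((l : ℝ) - i + 1) else 0) := by
  have hi0 : (i : ℝ) + 1 ≠ 0 := by positivity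
  rw [matC₂, matC₂]
  rcases lt_trichotomy k i with h | rfl | h
  · rw [if_neg (by omega), if_neg (by omega : ¬ i + 2 ≤ k + 1),
      if_neg (by omega : ¬ k + 2 = i + 2), if_neg (by omega : ¬ k = i)]
    by_cases hki : k + 1 = i
    · rw [if_pos (by omega), if_pos hki]
      push_cast
      field_simp
      ring
    · rw [if_neg (by omega), if_neg hki]
      ring
  · rw [if_pos le_rfl, if_neg (by omega), if_pos rfl, if_pos rfl, if_neg (by omega),
      show k + 1 + k = 2 * k + 1 by omega, pow_succ, pow_mul]
    push_cast
    have hk2 : (k : ℝ) + 2 ≠ 0 := by positivity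
    norm_num
    field_simp
    ring
  · rw [if_pos (by omega), if_pos (by omega), if_neg (by omega), if_neg (by omega),
      show i + 2 + k = i + 1 + k + 1 by omega, pow_succ]
    ring

lemma sum_Icc_ite_eq_mul (n j : ℕ) (c : ℝ) (u : ℕ → ℝ) (hj : j ∉ Icc 1 n → u j = 0) :
    ∑ k ∈ Icc 1 n, (if k = j then c else 0) * u k = c * u j := by
  simp_rw [ite_mul, zero_mul]
  rw [sum_ite_eq' (Icc 1 n) j]
  split_ifs with h
  · rfl
  · rw [hj h, mul_zero]

/-- The right-hand side of the recursion for the hooks of weight `n + 1`. -/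
def hookStep (l : ℕ) (α s : ℝ) (n : ℕ) (u v w : ℕ → ℝ) (j : ℕ) : ℝ :=
  -∑ k ∈ Icc 1 n, matB (n + 1) j k * u k
    - 1 / s * ∑ k ∈ Icc 1 n, matC₁ l α (n + 1) j k * v k
    + ∑ k ∈ Icc 1 (n - 1), matC₂ l j k * w k

/-- Row `n + 2` lies below the subdiagonals of `B` and `C₁` and the second subdiagonal of `C₂`. The
zero matches the vanishing hook polynomial with one row too many. -/
lemma hookStep_top (s : ℝ) (n : ℕ) (u v w : ℕ → ℝ) :
    hookStep l α s n u v w (n + 2) = 0 := by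
  rw [hookStep, sum_eq_zero, sum_eq_zero, sum_eq_zero]
  · simp
  · intro k hk
    have := mem_Icc.1 hk
    rw [matC₂, if_neg (by omega), if_neg (by omega), zero_mul]
  · intro k hk
    have := mem_Icc.1 hk
    rw [matC₁, if_neg (by omega), if_neg (by omega), zero_mul]
  · intro k hk
    have := mem_Icc.1 hk
    rw [matB, if_neg (by omega), if_neg (by omega), if_neg (by omega), zero_mul]

/-- The vanishing hypotheses at the ends account for the indices that fall outside the summation
ranges, so one formula covers every `i ≤ n`. -/
lemma hookStep_add_hookStep (s : ℝ) {n i : ℕ} (hi : i ≤ n) {u v w : ℕ → ℝ}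
    (hu : u 0 = 0) (hv : v 0 = 0) (hw : w 0 = 0) (hu' : u (n + 1) = 0) (hv' : v (n + 1) = 0)
    (hw' : w n = 0) :
    ((i : ℝ) + 1) * (hookStep l α s n u v w (i + 1) + hookStep l α s n u v w (i + 2)) =
      u i + u (i + 1) - (l - i + 1) * (w (i - 1) + w i)
        + 1 / s * (i * (2 * l - i + α) * (v i + v (i + 1)) + (n - i) * v i - i * v (i + 1)) := by
  have hB : ((i : ℝ) + 1) * (∑ k ∈ Icc 1 n, matB (n + 1) (i + 1) k * u k
      + ∑ k ∈ Icc 1 n, matB (n + 1) (i + 2) k * u k) = -u (i + 1) - u i := by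
    have h : ∀ k ∈ Icc 1 n, ((i : ℝ) + 1) * (matB (n + 1) (i + 1) k * u k
        + matB (n + 1) (i + 2) k * u k) =
        (if k = i + 1 then -1 else 0) * u k + (if k = i then -1 else 0) * u k := fun k hk => by
      rw [← add_mul, ← mul_assoc, matB_add_matB n i k (mem_Icc.1 hk).1 (mem_Icc.1 hk).2, add_mul]
    rw [← sum_add_distrib, mul_sum, sum_congr rfl h, sum_add_distrib, sum_Icc_ite_eq_mul,
      sum_Icc_ite_eq_mul]
    · ring
    · intro h
      rw [mem_Icc] at h
      rwa [show i = 0 by omega]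
    · intro h
      rw [mem_Icc] at h
      rwa [show i = n by omega]
  have hC₁ : ((i : ℝ) + 1) * (∑ k ∈ Icc 1 n, matC₁ l α (n + 1) (i + 1) k * v k
      + ∑ k ∈ Icc 1 n, matC₁ l α (n + 1) (i + 2) k * v k) =
      -((i : ℝ) * (2 * l - i - 1 + α)) * v (i + 1) - ((i : ℝ) * (2 * l - i + α) + n - i) * v i := by
    have h : ∀ k ∈ Icc 1 n, ((i : ℝ) + 1) * (matC₁ l α (n + 1) (i + 1) k * v k
        + matC₁ l α (n + 1) (i + 2) k * v k) =
        (if k = i + 1 then -((i : ℝ) * (2 * l - i - 1 + α)) else 0) * v k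
        + (if k = i then -((i : ℝ) * (2 * l - i + α) + n - i) else 0) * v k := fun k hk => by
      rw [← add_mul, ← mul_assoc, matC₁_add_matC₁ l α n i k (mem_Icc.1 hk).1, add_mul]
    rw [← sum_add_distrib, mul_sum, sum_congr rfl h, sum_add_distrib, sum_Icc_ite_eq_mul,
      sum_Icc_ite_eq_mul]
    · ring
    · intro h
      rw [mem_Icc] at h
      rwa [show i = 0 by omega]
    · intro h
      rw [mem_Icc] at h
      rwa [show i = n by omega]
  have hC₂ : ((i : ℝ) + 1) * (∑ k ∈ Icc 1 (n - 1), matC₂ l (i + 1) k * w k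
      + ∑ k ∈ Icc 1 (n - 1), matC₂ l (i + 2) k * w k) =
      -((l : ℝ) - i + 1) * (w (i - 1) + w i) := by
    have h : ∀ k ∈ Icc 1 (n - 1), ((i : ℝ) + 1) * (matC₂ l (i + 1) k * w k
        + matC₂ l (i + 2) k * w k) =
        (if k = i then -((l : ℝ) - i + 1) else 0) * w k
        + (if k = i - 1 then -((l : ℝ) - i + 1) else 0) * w k := fun k hk => by
      have hk1 := (mem_Icc.1 hk).1
      rw [← add_mul, ← mul_assoc, matC₂_add_matC₂ l i k, add_mul]
      have : k + 1 = i ↔ k = i - 1 := by omega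
      simp only [this]
    rw [← sum_add_distrib, mul_sum, sum_congr rfl h, sum_add_distrib, sum_Icc_ite_eq_mul,
      sum_Icc_ite_eq_mul]
    · ring
    · intro h
      rw [mem_Icc] at h
      rwa [show i - 1 = 0 by omega]
    · intro h
      rw [mem_Icc] at h
      rcases Nat.eq_zero_or_pos i with rfl | hi0
      · exact hw
      · rwa [show i = n by omega]
  simp only [hookStep]
  linear_combination -hB - 1 / s * hC₁ + hC₂

/-- Sums of neighbours together with the zero at `n + 2` determine a sequence, by descent from the
top. -/
lemma eq_hookStep {s : ℝ} {n : ℕ} {u v w t : ℕ → ℝ}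
    (hu : u 0 = 0) (hv : v 0 = 0) (hw : w 0 = 0) (hu' : u (n + 1) = 0) (hv' : v (n + 1) = 0)
    (hw' : w n = 0) (ht' : t (n + 2) = 0)
    (ht : ∀ i ≤ n, ((i : ℝ) + 1) * (t (i + 1) + t (i + 2)) =
      u i + u (i + 1) - (l - i + 1) * (w (i - 1) + w i)
        + 1 / s * (i * (2 * l - i + α) * (v i + v (i + 1)) + (n - i) * v i - i * v (i + 1)))
    {j : ℕ} (hj : 1 ≤ j) (hjn : j ≤ n + 2) : hookStep l α s n u v w j = t j := by
  revert hj
  induction hjn using Nat.decreasingInduction with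
  | self => intro _; rw [hookStep_top, ht']
  | of_succ j hjn ih =>
    intro hj
    obtain ⟨i, rfl⟩ := Nat.exists_eq_add_of_le' hj
    have h1 := hookStep_add_hookStep (l := l) (α := α) s (Nat.le_of_lt_succ (by omega) : i ≤ n)
      hu hv hw hu' hv' hw'
    rw [← ht i (by omega), ih (by omega)] at h1
    have h2 := mul_left_cancel₀ (by positivity : (i : ℝ) + 1 ≠ 0) h1
    linarith

end

section

open MvPolynomial Finset

variable {l : ℕ} {α x : ℝ}

/-! ### The hook functions of the Hankel determinant are averages of hook Schur polynomials -/

lemma average_sum_X_mul (hα : 0 ≤ α) (hx : 0 < x) {p : MvPolynomial (Fin l) ℝ} {m : ℕ}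
    (hp : p.IsHomogeneous m) :
    average l α ((∑ i, X i) * p) x = √x * deriv (average l α p) x
      - ((l : ℝ) ^ 2 + l * (α - 1) + m) / (2 * √x) * average l α p x := by
  have hs : √x ≠ 0 := (Real.sqrt_pos.2 hx).ne'
  have hxs : x = √x * √x := (Real.mul_self_sqrt hx.le).symm
  rw [(hasDerivAt_average hα hx hp).deriv]
  generalize average l α p x = a
  generalize average l α ((∑ i, X i) * p) x = c
  generalize √x = s at *
  subst hxs
  field_simp
  ring

/-- By Pieri, the sums of neighbouring hooks are products `e · h`, and the claim for `i = b + 1` is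
the loop equation with `k = n - b`, solved for the `e_{b+2}` term. For `i = 0` it is a tautology. -/
lemma average_hookSchur_relation (hα : 0 ≤ α) (hx : 0 < x) {n i : ℕ} (hi : i ≤ n + 1) :
    ((i : ℝ) + 1) * (average l α (hookSchur l (n + 2) (i + 1)) x
        + average l α (hookSchur l (n + 2) (i + 2)) x) =
      average l α ((∑ i, X i) * hookSchur l (n + 1) i) x
        + average l α ((∑ i, X i) * hookSchur l (n + 1) (i + 1)) x
        - (l - i + 1) * (if i = 0 then 0 else
          average l α (elemSymm l (i - 1) * compSymm l (n + 1 - i)) x)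
        + 1 / √x * (i * (2 * l - i + α) * (average l α (hookSchur l (n + 1) i) x
            + average l α (hookSchur l (n + 1) (i + 1)) x)
          + ((n + 1 : ℕ) - i) * average l α (hookSchur l (n + 1) i) x
          - i * average l α (hookSchur l (n + 1) (i + 1)) x) := by
  have hs : √x ≠ 0 := (Real.sqrt_pos.2 hx).ne'
  have e0 := hookSchur_add_succ (l := l) (n + 1) i
  have e1 := hookSchur_add_succ (l := l) (n + 2) (i + 1)
  rw [show n + 2 - (i + 1) = n + 1 - i by omega] at e1
  rw [← average_add, ← average_add, ← average_add, ← mul_add, e0, e1]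
  rcases i with _ | b
  · simp [hookSchur, average_zero, elemSymm, esymm_one]
  · have h := average_loop_equation (l := l) hα hx b (n + 1 - (b + 1))
    rw [show n + 1 - (b + 1) + (b + 1) = n + 1 by omega,
      Nat.cast_sub (show b + 1 ≤ n + 1 by omega)] at h
    rw [if_neg (Nat.succ_ne_zero b), Nat.add_sub_cancel]
    push_cast at h ⊢
    field_simp
    linear_combination -h

lemma hookTau_one (hα : 0 ≤ α) (hx : 0 < x) :
    hookTau l α (tau l α) 1 1 x = average l α (hookSchur l 1 1) x := by
  have h1 : hookSchur l 1 1 = (∑ i, X i) * 1 := by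
    rw [hookSchur_self one_ne_zero, elemSymm, esymm_one, mul_one]
  have ht : average l α 1 = tau l α := funext fun y => average_one
  rw [h1, average_sum_X_mul hα hx (isHomogeneous_one _ _), ht, hookTau, Nat.cast_zero, add_zero]

/-- Weight two is prescribed explicitly, so it must be checked against the same hook relations: `r0`
gives the sum of the two hooks and `r1` twice the second. -/
lemma hookTau_two (hα : 0 ≤ α) (hx : 0 < x) {j : ℕ} (hj : 1 ≤ j) (hj2 : j ≤ 2) :
    hookTau l α (tau l α) 2 j x = average l α (hookSchur l 2 j) x := by
  have hs : √x ≠ 0 := (Real.sqrt_pos.2 hx).ne'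
  have hxs : x = √x * √x := (Real.mul_self_sqrt hx.le).symm
  have hhom : (hookSchur l 1 1).IsHomogeneous 1 := hookSchur_isHomogeneous (by norm_num)
  have hev : average l α (hookSchur l 1 1) =ᶠ[nhds x]
      hookTau l α (tau l α) 1 1 := by
    filter_upwards [lt_mem_nhds hx] with y hy using (hookTau_one hα hy).symm
  have hsm := contDiffOn_tau l hα
  have hd0 : HasDerivAt (tau l α) (deriv (tau l α) x) x :=
    ((hsm.contDiffAt (Ioi_mem_nhds hx)).differentiableAt (by simp)).hasDerivAt
  have hd1 : HasDerivAt (deriv (tau l α)) (iteratedDeriv 2 (tau l α) x) x := by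
    rw [iteratedDeriv_succ, iteratedDeriv_one]
    have h := (contDiffOn_infty_iff_deriv_of_isOpen isOpen_Ioi).1 hsm
    exact ((h.2.contDiffAt (Ioi_mem_nhds hx)).differentiableAt (by simp)).hasDerivAt
  have hd : HasDerivAt (hookTau l α (tau l α) 1 1)
      (1 / (2 * √x) * deriv (tau l α) x + √x * iteratedDeriv 2 (tau l α) x
        - ((l : ℝ) ^ 2 + l * (α - 1)) / (2 * √x) * deriv (tau l α) x
        + ((l : ℝ) ^ 2 + l * (α - 1)) / (4 * x * √x) * tau l α x) x := by
    have h := ((Real.hasDerivAt_sqrt hx.ne').mul hd1).sub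
      (((hasDerivAt_const x ((l : ℝ) ^ 2 + l * (α - 1))).div
        ((Real.hasDerivAt_sqrt hx.ne').const_mul 2) (by positivity)).mul hd0)
    refine HasDerivAt.congr_deriv (f := hookTau l α (tau l α) 1 1) h ?_
    simp only [Pi.div_apply]
    generalize tau l α x = a
    generalize deriv (tau l α) x = b
    generalize iteratedDeriv 2 (tau l α) x = c
    generalize √x = s at *
    subst hxs
    field_simp
    ring
  have hp := average_sum_X_mul hα hx hhom
  rw [hev.deriv_eq, hd.deriv, ← hookTau_one hα hx, hookTau] at hp
  have r0 := average_hookSchur_relation (l := l) (n := 0) hα hx (Nat.zero_le 1)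
  have r1 := average_hookSchur_relation (l := l) (n := 0) hα hx (le_refl 1)
  have ht : average l α (elemSymm l 0 * compSymm l 0) x = tau l α x := by
    rw [elemSymm_zero, compSymm_zero, mul_one, average_one]
  have h11 := hookTau_one (l := l) hα hx
  rw [hookTau] at h11
  have z0 : hookSchur l 1 0 = 0 := rfl
  have z2 : hookSchur l 1 2 = 0 := hookSchur_self_succ one_ne_zero
  have z3 : hookSchur l 2 3 = 0 := hookSchur_self_succ two_ne_zero
  simp only [Nat.reduceAdd, Nat.cast_zero, Nat.cast_one, z0, z2, z3, mul_zero,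
    average_zero, zero_mul, zero_add, add_zero, sub_zero, if_true, one_ne_zero, if_false,
    Nat.sub_self, ht, ← h11, hp, one_mul, sub_self] at r0 r1
  have h2 : j = 1 ∨ j = 2 := by omega
  rcases h2 with rfl | rfl
  · have : average l α (hookSchur l 2 1) x =
        (average l α (hookSchur l 2 1) x + average l α (hookSchur l 2 2) x)
          - (1 + 1) * average l α (hookSchur l 2 2) x / 2 := by ring
    rw [this, r0, r1, hookTau, if_pos rfl]
    generalize tau l α x = a
    generalize deriv (tau l α) x = b
    generalize iteratedDeriv 2 (tau l α) x = c
    generalize √x = s at *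
    subst hxs
    field_simp
    ring
  · have : average l α (hookSchur l 2 2) x =
        (1 + 1) * average l α (hookSchur l 2 2) x / 2 := by ring
    rw [this, r1, hookTau, if_neg (by norm_num)]
    generalize tau l α x = a
    generalize deriv (tau l α) x = b
    generalize iteratedDeriv 2 (tau l α) x = c
    generalize √x = s at *
    subst hxs
    field_simp
    ring

theorem hookTau_tau (hα : 0 ≤ α) {m : ℕ} (hm : 1 ≤ m) :
    ∀ {j : ℕ}, 1 ≤ j → j ≤ m → ∀ {x : ℝ}, 0 < x →
      hookTau l α (tau l α) m j x = average l α (hookSchur l m j) x := by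
  induction m using Nat.strong_induction_on with
  | _ m ih =>
    intro j hj hjm x hx
    match m, hm, hjm, ih with
    | 1, _, hjm, _ =>
      obtain rfl : j = 1 := by omega
      exact hookTau_one hα hx
    | 2, _, hjm, _ => exact hookTau_two hα hx hj hjm
    | m + 3, _, hjm, ih =>
      have hv : ∀ k ∈ Icc 1 (m + 2), hookTau l α (tau l α) (m + 2) k x =
          average l α (hookSchur l (m + 2) k) x := fun k hk =>
        ih (m + 2) (by omega) (by omega) (mem_Icc.1 hk).1 (mem_Icc.1 hk).2 hx
      have hw : ∀ k ∈ Icc 1 (m + 1), hookTau l α (tau l α) (m + 1) k x =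
          average l α (hookSchur l (m + 1) k) x := fun k hk =>
        ih (m + 1) (by omega) (by omega) (mem_Icc.1 hk).1 (mem_Icc.1 hk).2 hx
      have hd : ∀ k ∈ Icc 1 (m + 2), deriv (hookTau l α (tau l α) (m + 2) k) x =
          deriv (average l α (hookSchur l (m + 2) k)) x := fun k hk => by
        -- Derivatives require the inductive identity on a neighbourhood of `x`, which is why `x` is
        -- quantified inside the induction.
        refine Filter.EventuallyEq.deriv_eq ?_
        filter_upwards [lt_mem_nhds hx] with y hy
        exact ih (m + 2) (by omega) (by omega) (mem_Icc.1 hk).1 (mem_Icc.1 hk).2 hy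
      have hu : ∀ k ∈ Icc 1 (m + 2), average l α ((∑ i, X i) * hookSchur l (m + 2) k) x =
          √x * deriv (average l α (hookSchur l (m + 2) k)) x
          - ((l : ℝ) ^ 2 + l * (α - 1) + (m + 2 : ℕ)) / (2 * √x)
            * average l α (hookSchur l (m + 2) k) x := fun k hk =>
        average_sum_X_mul hα hx (hookSchur_isHomogeneous (by have := (mem_Icc.1 hk).2; omega))
      have hz : hookSchur l (m + 2) 0 = 0 := rfl
      have hz' : hookSchur l (m + 1) 0 = 0 := rfl
      have hstep := eq_hookStep (l := l) (α := α) (s := √x) (n := m + 2)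
        (u := fun k => average l α ((∑ i, X i) * hookSchur l (m + 2) k) x)
        (v := fun k => average l α (hookSchur l (m + 2) k) x)
        (w := fun k => average l α (hookSchur l (m + 1) k) x)
        (t := fun k => average l α (hookSchur l (m + 3) k) x)
        (by simp only [hz, mul_zero, average_zero]) (by simp only [hz, average_zero])
        (by simp only [hz', average_zero])
        (by simp only [hookSchur_self_succ (Nat.succ_ne_zero (m + 1)), mul_zero, average_zero])
        (by simp only [hookSchur_self_succ (Nat.succ_ne_zero (m + 1)), average_zero])
        (by simp only [hookSchur_self_succ (Nat.succ_ne_zero m), average_zero])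
        (by simp only [hookSchur_self_succ (Nat.succ_ne_zero (m + 2)), average_zero])
        (fun i hi => by
          have h := average_hookSchur_relation (l := l) (n := m + 1) hα hx hi
          -- At `i = 0` the truncated index `i - 1` is again `0`, where the hook polynomial is zero,
          -- so both sides vanish.
          have hc : (if i = 0 then 0 else
              average l α (elemSymm l (i - 1) * compSymm l (m + 1 + 1 - i)) x) =
              average l α (hookSchur l (m + 1) (i - 1)) x
                + average l α (hookSchur l (m + 1) i) x := by
            rcases i with _ | i
            · simp only [hz', average_zero, if_true, add_zero]
            · rw [if_neg (Nat.succ_ne_zero i), Nat.add_sub_cancel, ← average_add,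
                hookSchur_add_succ, show m + 1 + 1 - (i + 1) = m + 1 - i by omega]
          rw [hc] at h
          exact h)
        hj (by omega)
      have sv : ∀ c : ℕ → ℝ, ∑ k ∈ Icc 1 (m + 2), c k * hookTau l α (tau l α) (m + 2) k x =
          ∑ k ∈ Icc 1 (m + 2), c k * average l α (hookSchur l (m + 2) k) x := fun c =>
        sum_congr rfl fun k hk => by rw [hv k hk]
      have sw : ∀ c : ℕ → ℝ, ∑ k ∈ Icc 1 (m + 1), c k * hookTau l α (tau l α) (m + 1) k x =
          ∑ k ∈ Icc 1 (m + 1), c k * average l α (hookSchur l (m + 1) k) x := fun c =>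
        sum_congr rfl fun k hk => by rw [hw k hk]
      have sd : ∀ c : ℕ → ℝ, ∑ k ∈ Icc 1 (m + 2), c k * deriv (hookTau l α (tau l α) (m + 2) k) x =
          ∑ k ∈ Icc 1 (m + 2), c k * deriv (average l α (hookSchur l (m + 2) k)) x := fun c =>
        sum_congr rfl fun k hk => by rw [hd k hk]
      rw [← hstep, hookTau, hookStep, sd, sv, sv, sw]
      have hus : ∑ k ∈ Icc 1 (m + 2), matB (m + 2 + 1) j k
          * average l α ((∑ i, X i) * hookSchur l (m + 2) k) x =
          √x * ∑ k ∈ Icc 1 (m + 2), matB (m + 3) j k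
            * deriv (average l α (hookSchur l (m + 2) k)) x
          - ((l : ℝ) ^ 2 + l * (α - 1) + (m + 2 : ℕ)) / (2 * √x)
            * ∑ k ∈ Icc 1 (m + 2), matB (m + 3) j k * average l α (hookSchur l (m + 2) k) x := by
        rw [mul_sum, mul_sum, ← sum_sub_distrib]
        exact sum_congr rfl fun k hk => by rw [hu k hk]; ring
      rw [hus]
      simp only [show m + 2 - 1 = m + 1 from rfl]
      push_cast
      ring

theorem hookTau_tau_succ_self (hα : 0 ≤ α) (hx : 0 < x) :
    hookTau l α (tau l α) (l + 1) (l + 1) x = 0 := by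
  rw [hookTau_tau hα (Nat.le_add_left 1 l) (Nat.le_add_left 1 l) le_rfl hx,
    hookSchur_self (Nat.succ_ne_zero l), elemSymm_eq_zero (Nat.lt_succ_self l), average_zero]

end

section

open Finset

variable {l : ℕ} {α x : ℝ} {f : ℝ → ℝ}

/-! ### The coefficients of the differential operators -/

/-- Give `d/dx` weight one and the extra factor `x` weight two: a step from `m - 1` raises `n` by at
most one, a step from `m - 2` raises `i` by one. -/
lemma hookCoeff_eq_zero (l : ℕ) (α : ℝ) (m : ℕ) :
    ∀ {j i n : ℕ}, m < n + 2 * i → hookCoeff l α m j i n = 0 := by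
  induction m using Nat.strong_induction_on with
  | _ m ih =>
    intro j i n h
    match m, ih, h with
    | 0, _, h => rw [hookCoeff, if_neg (by omega)]
    | 1, _, h => rw [hookCoeff, if_neg (by omega), if_neg (by omega)]
    | 2, _, h =>
      rw [hookCoeff, if_neg (by omega), if_neg (by omega), if_neg (by omega), if_neg (by omega)]
    | m + 3, ih, h =>
      have h1 : ∀ k, hookCoeff l α (m + 2) k i n = 0 := fun k => ih _ (by omega) (by omega)
      have h2 : ∀ k, (if n = 0 then 0 else hookCoeff l α (m + 2) k i (n - 1)) = 0 := fun k => by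
        split_ifs
        · rfl
        · exact ih _ (by omega) (by omega)
      have h3 : ∀ k, (if i = 0 then 0 else hookCoeff l α (m + 1) k (i - 1) n) = 0 := fun k => by
        split_ifs
        · rfl
        · exact ih _ (by omega) (by omega)
      rw [hookCoeff]
      simp [h1, h2, h3]

/-- Only the term that differentiates once more can reach order `m`, and in the last row of `B` only
the subdiagonal entry `-1/m` contributes; these factors multiply to `1/m!`. -/
lemma hookCoeff_top (l : ℕ) (α : ℝ) (m : ℕ) : hookCoeff l α m m 0 m = 1 / (m ! : ℝ) := by
  induction m using Nat.strong_induction_on with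
  | _ m ih =>
    match m, ih with
    | 0, _ => simp [hookCoeff]
    | 1, _ => simp [hookCoeff]
    | 2, _ => simp [hookCoeff]
    | m + 3, ih =>
      have h1 : ∀ k, hookCoeff l α (m + 2) k 0 (m + 3) = 0 := fun k =>
        hookCoeff_eq_zero l α _ (by omega)
      rw [hookCoeff]
      simp only [h1, mul_zero, sum_const_zero, if_true, zero_add, sub_zero, add_zero,
        if_neg (Nat.succ_ne_zero (m + 2)), show m + 3 - 1 = m + 2 from rfl]
      rw [sum_eq_single (m + 2), ih (m + 2) (by omega), matB, if_neg (by omega),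
        if_neg (by omega), if_pos rfl, Nat.factorial_succ (m + 2)]
      · have : ((m + 2)! : ℝ) ≠ 0 := by exact_mod_cast Nat.factorial_ne_zero _
        push_cast
        field_simp
        ring
      · intro k hk hk'
        have := mem_Icc.1 hk
        rw [matB, if_neg (by omega), if_neg (by omega), if_neg (by omega), zero_mul]
      · intro h
        simp at h

/-- The differential expression `∑_{n, i < N} b_{i,n} x^(n+i) f^(n)(x)`, linear in the
coefficients. -/
def diffExpr (N : ℕ) (f : ℝ → ℝ) (x : ℝ) : (ℕ → ℕ → ℝ) →ₗ[ℝ] ℝ where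
  toFun b := ∑ n ∈ range N, ∑ i ∈ range N, b i n * (x ^ (n + i) * iteratedDeriv n f x)
  map_add' b c := by simp only [Pi.add_apply, add_mul, sum_add_distrib]
  map_smul' r b := by simp only [Pi.smul_apply, smul_eq_mul, mul_sum, mul_assoc, RingHom.id_apply]

lemma diffExpr_apply (N : ℕ) (f : ℝ → ℝ) (x : ℝ) (b : ℕ → ℕ → ℝ) : diffExpr N f x b =
    ∑ n ∈ range N, ∑ i ∈ range N, b i n * (x ^ (n + i) * iteratedDeriv n f x) := rfl

lemma diffExpr_single {N a c : ℕ} (ha : a < N) (hc : c < N) (r : ℝ) :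
    diffExpr N f x (fun i n => if i = a ∧ n = c then r else 0) =
      r * (x ^ (c + a) * iteratedDeriv c f x) := by
  rw [diffExpr_apply, sum_eq_single c, sum_eq_single a]
  · simp
  · intro i _ hi
    simp [hi]
  · intro h
    exact absurd (mem_range.2 ha) h
  · intro n _ hn
    simp [hn]
  · intro h
    exact absurd (mem_range.2 hc) h

lemma sum_range_shift {N : ℕ} (g w : ℕ → ℝ) (hg : ∀ n, N ≤ n + 1 → g n = 0) :
    ∑ n ∈ range N, (if n = 0 then 0 else g (n - 1)) * w n = ∑ n ∈ range N, g n * w (n + 1) := by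
  rcases N with _ | N
  · simp
  · rw [sum_range_succ', sum_range_succ (fun n => g n * w (n + 1)), hg N le_rfl]
    simp

lemma diffExpr_shift_left {N : ℕ} {b : ℕ → ℕ → ℝ} (hb : ∀ i n, N ≤ i + 1 → b i n = 0) :
    diffExpr N f x (fun i n : ℕ => if i = 0 then 0 else b (i - 1) n) = x * diffExpr N f x b := by
  rw [diffExpr_apply, diffExpr_apply, mul_sum]
  refine sum_congr rfl fun n _ => ?_
  rw [sum_range_shift (fun i => b i n) (fun i => x ^ (n + i) * iteratedDeriv n f x)
    fun i hi => hb i n hi, mul_sum]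
  exact sum_congr rfl fun i _ => by ring

lemma hasDerivAt_iteratedDeriv (hf : ContDiffOn ℝ ∞ f (Set.Ioi 0)) (hx : 0 < x) (n : ℕ) :
    HasDerivAt (iteratedDeriv n f) (iteratedDeriv (n + 1) f x) x := by
  have h : ∀ n, ContDiffOn ℝ ∞ (iteratedDeriv n f) (Set.Ioi 0) := fun n => by
    induction n with
    | zero => rwa [iteratedDeriv_zero]
    | succ n ih =>
      rw [iteratedDeriv_succ]
      exact ((contDiffOn_infty_iff_deriv_of_isOpen isOpen_Ioi).1 ih).2
  rw [iteratedDeriv_succ]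
  exact (((h n).contDiffAt (Ioi_mem_nhds hx)).differentiableAt (by simp)).hasDerivAt

/-- `x d/dx` sends `x^(n+i) f^(n)` to `(n+i) x^(n+i) f^(n) + x^(n+1+i) f^(n+1)`. The vanishing of
the last coefficients keeps the shifted sum inside the range `N`. -/
lemma hasDerivAt_diffExpr (hf : ContDiffOn ℝ ∞ f (Set.Ioi 0)) (hx : 0 < x) {N : ℕ}
    {b : ℕ → ℕ → ℝ} (hb : ∀ i n, N ≤ n + 1 → b i n = 0) :
    HasDerivAt (fun y => diffExpr N f y b)
      (diffExpr N f x (fun i n : ℕ => ((n : ℝ) + i) * b i n + if n = 0 then 0 else b i (n - 1)) / x)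
      x := by
  have h : HasDerivAt (fun y => diffExpr N f y b) (∑ n ∈ range N, ∑ i ∈ range N,
      b i n * (((n + i : ℕ) * x ^ (n + i - 1)) * iteratedDeriv n f x
        + x ^ (n + i) * iteratedDeriv (n + 1) f x)) x := by
    simp only [diffExpr_apply]
    refine HasDerivAt.fun_sum fun n _ => ?_
    refine HasDerivAt.fun_sum fun i _ => ?_
    exact ((hasDerivAt_pow (n + i) x).mul (hasDerivAt_iteratedDeriv hf hx n)).const_mul _
  refine h.congr_deriv ?_
  have hsplit : (fun i n : ℕ => ((n : ℝ) + i) * b i n + if n = 0 then 0 else b i (n - 1)) =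
      (fun i n : ℕ => ((n : ℝ) + i) * b i n) + fun i n : ℕ => if n = 0 then 0 else b i (n - 1) := rfl
  have hshift : diffExpr N f x (fun i n : ℕ => if n = 0 then 0 else b i (n - 1)) =
      ∑ n ∈ range N, ∑ i ∈ range N, b i n * (x ^ (n + 1 + i) * iteratedDeriv (n + 1) f x) := by
    rw [diffExpr_apply]
    refine sum_comm.trans ((sum_congr rfl fun i _ => ?_).trans sum_comm)
    exact sum_range_shift (fun n => b i n) (fun n => x ^ (n + i) * iteratedDeriv n f x)
      fun n hn => hb i n hn
  rw [hsplit, map_add, hshift, diffExpr_apply, eq_div_iff hx.ne', sum_mul, ← sum_add_distrib]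
  refine sum_congr rfl fun n _ => ?_
  rw [sum_mul, ← sum_add_distrib]
  refine sum_congr rfl fun i _ => ?_
  rcases Nat.eq_zero_or_pos (n + i) with h0 | h0
  · obtain ⟨rfl, rfl⟩ : n = 0 ∧ i = 0 := by omega
    simp
    ring
  · obtain ⟨p, hp⟩ := Nat.exists_eq_add_of_le' h0
    have hc : (n : ℝ) + i = p + 1 := by exact_mod_cast hp
    rw [show n + 1 + i = n + i + 1 by ring, hc, hp, Nat.add_sub_cancel]
    push_cast
    ring

lemma hookCoeff_add_three (l : ℕ) (α : ℝ) (m j : ℕ) :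
    hookCoeff l α (m + 3) j =
      -∑ k ∈ Icc 1 (m + 2), matB (m + 3) j k •
          ((fun i n : ℕ => ((n : ℝ) + i) * hookCoeff l α (m + 2) k i n
              + if n = 0 then 0 else hookCoeff l α (m + 2) k i (n - 1))
            - (((m + 2 : ℕ) : ℝ) / 2) • hookCoeff l α (m + 2) k)
        + (((l : ℝ) ^ 2 + l * (α - 1) + ((m + 3 : ℕ) : ℝ) - 1) / 2) •
          ∑ k ∈ Icc 1 (m + 2), matB (m + 3) j k • hookCoeff l α (m + 2) k
        - ∑ k ∈ Icc 1 (m + 2), matC₁ l α (m + 3) j k • hookCoeff l α (m + 2) k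
        + ∑ k ∈ Icc 1 (m + 1), matC₂ l j k •
          fun i n : ℕ => if i = 0 then 0 else hookCoeff l α (m + 1) k (i - 1) n := by
  funext i n
  rw [hookCoeff]
  simp only [Pi.add_apply, Pi.sub_apply, Pi.neg_apply, Pi.smul_apply, Finset.sum_apply,
    smul_eq_mul]
  congr 3
  refine congrArg Neg.neg (sum_congr rfl fun k _ => ?_)
  ring

/-- A common bound `N` puts the operators of all weights `m < N` in one space, where the coefficient
recursion is an identity of linear combinations and the linear map `diffExpr` can be applied to it.
-/
theorem hookTau_eq_diffExpr (hf : ContDiffOn ℝ ∞ f (Set.Ioi 0)) {N : ℕ} (m : ℕ) :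
    m < N → ∀ (j : ℕ) {x : ℝ}, 0 < x →
      hookTau l α f m j x = x ^ (-(m : ℝ) / 2) * diffExpr N f x (hookCoeff l α m j) := by
  induction m using Nat.strong_induction_on with
  | _ m ih =>
    intro hm j x hx
    have hs : √x ≠ 0 := (Real.sqrt_pos.2 hx).ne'
    have hxs : x = √x * √x := (Real.mul_self_sqrt hx.le).symm
    match m, ih, hm with
    | 0, _, hm =>
      have h : hookCoeff l α 0 j = fun i n => if i = 0 ∧ n = 0 then 1 else 0 := by
        funext i n; rw [hookCoeff]
      rw [h, diffExpr_single hm hm, hookTau]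
      simp
    | 1, _, hm =>
      have h : hookCoeff l α 1 j = (fun i n => if i = 0 ∧ n = 1 then 1 else 0)
          + fun i n => if i = 0 ∧ n = 0 then -((l : ℝ) ^ 2 + l * (α - 1)) / 2 else 0 := by
        funext i n
        rw [hookCoeff, Pi.add_apply, Pi.add_apply]
        split_ifs <;> first | omega | simp
      have hp : x ^ (-((1 : ℕ) : ℝ) / 2) = 1 / √x := by
        rw [neg_div, Real.rpow_neg hx.le, Real.sqrt_eq_rpow, Nat.cast_one, one_div, one_div]
      rw [h, map_add, diffExpr_single (by omega) (by omega), diffExpr_single (by omega) (by omega),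
        hookTau, hp, iteratedDeriv_one, iteratedDeriv_zero]
      generalize f x = a
      generalize deriv f x = b
      generalize √x = s at *
      subst hxs
      field_simp
      ring
    | 2, _, hm =>
      have hp : x ^ (-((2 : ℕ) : ℝ) / 2) = 1 / x := by
        rw [neg_div, Nat.cast_two, div_self two_ne_zero, Real.rpow_neg_one, one_div]
      have h : hookCoeff l α 2 j = (fun i n => if i = 0 ∧ n = 2 then 1 / 2 else 0)
          + (fun i n => if i = 0 ∧ n = 1 then
            (if j = 1 then -(l * (l + α + 1) + α - 1) / 2 else -(l * (l + α - 3) - (α - 1)) / 2)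
            else 0)
          + (fun i n => if i = 0 ∧ n = 0 then
            (if j = 1 then
              ((l : ℝ) ^ 2 + l * (α - 1)) * ((l : ℝ) ^ 2 + l * (α + 3) + 2 * α) / 8
            else ((l : ℝ) ^ 2 + l * (α - 1)) * ((l : ℝ) ^ 2 + l * (α - 5) + 4 - 2 * α) / 8) else 0)
          + fun i n => if i = 1 ∧ n = 0 then (if j = 1 then (l : ℝ) / 2 else -(l : ℝ) / 2)
            else 0 := by
        funext i n
        rw [hookCoeff]
        simp only [Pi.add_apply]
        by_cases h1 : i = 0 ∧ n = 2
        · obtain ⟨rfl, rfl⟩ := h1; simp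
        by_cases h2 : i = 0 ∧ n = 1
        · obtain ⟨rfl, rfl⟩ := h2; simp
        by_cases h3 : i = 0 ∧ n = 0
        · obtain ⟨rfl, rfl⟩ := h3; simp
        by_cases h4 : i = 1 ∧ n = 0
        · obtain ⟨rfl, rfl⟩ := h4; simp
        simp only [h1, h2, h3, h4, if_false, add_zero]
      rw [h, map_add, map_add, map_add, diffExpr_single (by omega) (by omega),
        diffExpr_single (by omega) (by omega), diffExpr_single (by omega) (by omega),
        diffExpr_single (by omega) (by omega), hookTau, hp, iteratedDeriv_one, iteratedDeriv_zero]
      split_ifs <;> field_simp <;> ring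
    | m + 3, ih, hm =>
      have hE : ∀ k, deriv (hookTau l α f (m + 2) k) x =
          x ^ (-((m + 2 : ℕ) : ℝ) / 2) / x * (diffExpr N f x
            (fun i n : ℕ => ((n : ℝ) + i) * hookCoeff l α (m + 2) k i n
              + if n = 0 then 0 else hookCoeff l α (m + 2) k i (n - 1))
            - ((m + 2 : ℕ) : ℝ) / 2 * diffExpr N f x (hookCoeff l α (m + 2) k)) := fun k => by
        have hev : hookTau l α f (m + 2) k =ᶠ[nhds x] (fun y => y ^ (-((m + 2 : ℕ) : ℝ) / 2))
            * fun y => diffExpr N f y (hookCoeff l α (m + 2) k) := by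
          filter_upwards [lt_mem_nhds hx] with y hy
          exact ih (m + 2) (by omega) (by omega) k hy
        rw [hev.deriv_eq, ((Real.hasDerivAt_rpow_const (Or.inl hx.ne')).mul
          (hasDerivAt_diffExpr hf hx
            fun i n hn => hookCoeff_eq_zero l α (m + 2) (by omega))).deriv, Real.rpow_sub hx,
          Real.rpow_one]
        ring
      have hS : ∀ k, diffExpr N f x (fun i n : ℕ => if i = 0 then 0 else
          hookCoeff l α (m + 1) k (i - 1) n) = x * diffExpr N f x (hookCoeff l α (m + 1) k) :=
        fun k => diffExpr_shift_left fun i n hi => hookCoeff_eq_zero l α (m + 1) (by omega)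
      -- All prefactors are expressed through the power for weight `m + 3`, which then factors out
      -- of every term.
      have hp1 : x ^ (-((m + 1 : ℕ) : ℝ) / 2) = x * x ^ (-((m + 3 : ℕ) : ℝ) / 2) := by
        nth_rewrite 2 [← Real.rpow_one x]
        rw [← Real.rpow_add hx]
        congr 1
        push_cast
        ring
      have hp2 : x ^ (-((m + 2 : ℕ) : ℝ) / 2) = √x * x ^ (-((m + 3 : ℕ) : ℝ) / 2) := by
        rw [Real.sqrt_eq_rpow, ← Real.rpow_add hx]
        congr 1
        push_cast
        ring
      rw [hookTau, hookCoeff_add_three]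
      simp only [map_add, map_sub, map_neg, map_sum, map_smul, smul_eq_mul, hS, hE,
        ih (m + 2) (by omega) (by omega) _ hx, ih (m + 1) (by omega) (by omega) _ hx, hp1, hp2]
      simp only [mul_add, mul_sub, mul_neg, mul_sum, neg_mul]
      congr 1
      · congr 1
        · congr 1
          · rw [← sum_neg_distrib]
            refine sum_congr rfl fun k _ => ?_
            have hx1 : √x * (√x / x) = 1 := by
              rw [← mul_div_assoc, ← hxs, div_self hx.ne']
            linear_combination (-matB (m + 3) j k * x ^ (-((m + 3 : ℕ) : ℝ) / 2) *
              (diffExpr N f x (fun i n : ℕ => ((n : ℝ) + i) * hookCoeff l α (m + 2) k i n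
                + if n = 0 then 0 else hookCoeff l α (m + 2) k i (n - 1))
              - ((m + 2 : ℕ) : ℝ) / 2 * diffExpr N f x (hookCoeff l α (m + 2) k))) * hx1
          · refine sum_congr rfl fun k _ => ?_
            field_simp
        · refine sum_congr rfl fun k _ => ?_
          field_simp
      · refine sum_congr rfl fun k _ => ?_
        ring

lemma odeExpr_eq_diffExpr (l : ℕ) (α : ℝ) (f : ℝ → ℝ) (x : ℝ) :
    odeExpr l α f x = diffExpr (l + 2) f x (hookCoeff l α (l + 1) (l + 1)) := by
  rw [odeExpr, diffExpr_apply]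
  refine sum_congr rfl fun n hn => ?_
  rw [mul_sum, sum_mul]
  have hsub : range ((l + 1 - n) / 2 + 1) ⊆ range (l + 2) := fun i hi => by
    rw [mem_range] at *
    omega
  rw [← sum_subset hsub]
  · refine sum_congr rfl fun i _ => ?_
    rw [bCoeff]
    ring
  · intro i _ hi
    rw [mem_range] at *
    rw [hookCoeff_eq_zero l α (l + 1) (by omega), zero_mul]

theorem hookTau_eq_odeExpr (l : ℕ) (α : ℝ) (hf : ContDiffOn ℝ ∞ f (Set.Ioi 0)) (hx : 0 < x) :
    hookTau l α f (l + 1) (l + 1) x = x ^ (-((l : ℝ) + 1) / 2) * odeExpr l α f x := by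
  rw [hookTau_eq_diffExpr hf (l + 1) (Nat.lt_succ_self _) _ hx, odeExpr_eq_diffExpr,
    Nat.cast_succ]

theorem odeExpr_tau (l : ℕ) {α : ℝ} (hα : 0 ≤ α) (hx : 0 < x) :
    odeExpr l α (tau l α) x = 0 := by
  have h := hookTau_eq_odeExpr l α (contDiffOn_tau l hα) hx
  rw [hookTau_tau_succ_self hα hx] at h
  exact (mul_eq_zero.1 h.symm).resolve_left (Real.rpow_pos_of_pos hx _).ne'

end

end HankelODE

end

/-! ### Assembly of the theorem. -/

theorem mainTheorem3 (l : ℕ) (hl : 1 ≤ l) :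
    (∀ α : ℝ, 0 ≤ α →
      -- the base function is smooth, so that all derivatives below are genuine
      ContDiffOn ℝ ∞ (HankelODE.tau l α) (Set.Ioi 0) ∧
      -- the coefficients are those of the recursion, whatever smooth function it starts from
      (∀ f : ℝ → ℝ, ContDiffOn ℝ ∞ f (Set.Ioi 0) → ∀ x : ℝ, 0 < x →
        HankelODE.hookTau l α f (l + 1) (l + 1) x
          = x ^ (-((l : ℝ) + 1) / 2) * HankelODE.odeExpr l α f x) ∧
      -- the formula for the Hankel determinant
      (∀ x : ℝ, 0 < x →
        HankelODE.hookTau l α (HankelODE.tau l α) (l + 1) (l + 1) x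
          = x ^ (-((l : ℝ) + 1) / 2) * HankelODE.odeExpr l α (HankelODE.tau l α) x) ∧
      -- it vanishes identically
      (∀ x : ℝ, 0 < x → HankelODE.hookTau l α (HankelODE.tau l α) (l + 1) (l + 1) x = 0) ∧
      -- the linear differential equation, of order exactly `l + 1`
      (∀ x : ℝ, 0 < x → HankelODE.odeExpr l α (HankelODE.tau l α) x = 0) ∧
      HankelODE.bCoeff l α (l + 1) 0 (l + 1) ≠ 0) ∧
    -- the specialisation `α = 1`
    (∀ x : ℝ, 0 < x →
      HankelODE.odeExpr l 1
        (fun y => (Matrix.of fun j k : Fin l =>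
          HankelODE.besselI ((j : ℝ) + (k : ℝ) + 1) (2 * √y)).det) x = 0) := by
  refine ⟨fun α hα => ⟨HankelODE.contDiffOn_tau l hα,
    fun f hf x hx => HankelODE.hookTau_eq_odeExpr l α hf hx,
    fun x hx => HankelODE.hookTau_eq_odeExpr l α (HankelODE.contDiffOn_tau l hα) hx,
    fun x hx => HankelODE.hookTau_tau_succ_self hα hx,
    fun x hx => HankelODE.odeExpr_tau l hα hx, ?_⟩,
    -- The explicit determinant is `tau l 1` by definition.
    fun x hx => HankelODE.odeExpr_tau l zero_le_one hx⟩
  rw [HankelODE.bCoeff, HankelODE.hookCoeff_top]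
  exact one_div_ne_zero (by exact_mod_cast Nat.factorial_ne_zero _)
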